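/- **Setting.** Let $(\Omega,\mathcal A,\mathbb P)$ be a probability space, $(\Omega,\mathcal A)$ being a standard Borel space, with a measurable flow $\{\theta_x : x\in\mathbb R^d\}$ ($(\omega,x)\mapsto\theta_x\omega$ is measurable, $\theta_0=\mathrm{id}$, $\theta_x\circ\theta_y=\theta_{x+y}$) which preserves $\mathbb P$. A random measure $\Phi$ on $\mathbb R^d$ (a measurable map from $\Omega$ to the locally finite measures) is invariant if $\Phi(\omega,B+x)=\Phi(\theta_x\omega,B)$ for all $\omega$, $x$ and Borel $B$; it is locally square-integrable if $\mathbb E\,\Phi(B)^2<\infty$ for all bounded Borel $B$. A probability kernel $K$ from $\Omega\times\mathbb R^d$ to $\mathbb R^d$ is invariant if $K(\omega,x,B+x)=K(\theta_x\omega,0,B)$. Put $K_x(B)=K(\cdot,x,B)$, $K^*_x(B)=K_x(B+x)$ and $K\Phi(\omega,\cdot)=\int K(\omega,x,\cdot)\,\Phi(\omega,dx)$ (the destination). For an invariant, locally square-integrable random measure $\Psi$ with intensity $\gamma_\Psi=\mathbb E\,\Psi([0,1]^d)$ let $$\alpha_\Psi(B)=\mathbb E\int \mathbf 1\{x\in[0,1]^d,\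 y-x\in B\}\,\Psi^2(d(x,y)),\qquad \beta_\Psi=\alpha_\Psi-\gamma_\Psi^2\lambda_d ,$$ where $\lambda_d$ is Lebesgue measure. Fourier transforms are $\hat f(k)=\int f(x)e^{-i\langle k,x\rangle}dx$ and $\hat\nu(k)=\int e^{-i\langle k,x\rangle}\nu(dx)$ for finite (signed) measures $\nu$. The Bartlett spectral measure $\hat\beta_\Psi$ is the locally finite measure with $$\int (f\star g)\,d\beta_\Psi=\frac1{(2\pi)^d}\int \hat f(k)\overline{\hat g(k)}\,\hat\beta_\Psi(dk),\qquad (f\star g)(y)=\int f(x)g(x-y)\,dx,$$ the right-hand integral being absolutely convergent, for all bounded measurable $f,g:\mathbb R^d\to\mathbb R$ with bounded support. For an invariant, locally square-integrable $\Phi$ with positive intensity $\gamma$, the Palm probability measure is $\mathbb P^\Phi_0(A)=\gamma^{-1}\,\mathbb E\int_{[0,1]^d}\mathbf 1_A(\theta_x)\,\Phi(dx)$, with expectation $\mathbb E^\Phi_0$. The two-point Palm probabilities $\mathbb P^\Phi_{0,y}$, with expectations $\mathbb E^\Phi_{0,y}$, form a probability kernel from $\mathbb R^d$ to $\Omega$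 such that $$\mathbb E\int f(x,y,\theta_0)\,\Phi^2(d(x,y))=\iiint f(x,x+y,\theta_{-x}\omega)\,\mathbb P^\Phi_{0,y}(d\omega)\,\alpha_\Phi(dy)\,dx$$ for all measurable $f\ge 0$; any version may be used. The total variation norm is $\|\nu\|=\sup|\int f\,d\nu|$ over measurable $f$ with values in $[-1,1]$. **Theorem.** Let $\Phi$ be an invariant, locally square-integrable random measure on $\mathbb R^d$ with positive intensity, and let $K$ be an invariant probability kernel from $\Omega\times\mathbb R^d$ to $\mathbb R^d$. Let $$\kappa(y)=\big\|\mathbb E^\Phi_{0,y}[K^*_y\otimes K^*_0]-(\mathbb E^\Phi_0[K^*_0])^{\otimes2}\big\|$$ and assume $\int\kappa(y)\,\alpha_\Phi(dy)<\infty$. Let $L_0=\mathbb E^\Phi_0[K^*_0]$ and let $L$ be the non-random kernel $L(x,B)=L_0(B-x)$. Then $K\Phi$ and $L\Phi$ are locally square-integrable; there is a (unique) finite signed measure $\eta$ on $\mathbb R^d$ with $\eta(B)=\alpha_{K\Phi}(B)-\alpha_{L\Phi}(B)$ for every bounded Borel set $B$ (both terms being finite); the Bartlett spectral measure $\hat\beta_{K\Phi}$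 exists, is unique, and $$\hat\beta_{K\Phi}=\big|\mathbb E^\Phi_0[\hat K^*_0]\big|^2\cdot\hat\beta_\Phi+\hat\eta\cdot\lambda_d$$ as an identity of set functions on the bounded Borel sets. Moreover, for all $k\in\mathbb R^d$, $$\hat\eta(k)=\int e^{-i\langle k,y\rangle}\Big(\mathbb E^\Phi_{0,y}\big[\hat K^*_y(k)\overline{\hat K^*_0(k)}\big]-\big|\mathbb E^\Phi_0[\hat K^*_0(k)]\big|^2\Big)\,\alpha_\Phi(dy),$$ the integral being absolutely convergent, and $\hat\eta$ is continuous with $\hat\eta(0)=0$. -/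

import Mathlib

open MeasureTheory ProbabilityTheory
open scoped ENNReal ComplexConjugate

noncomputable section

/-- Euclidean space `ℝᵈ`. -/
abbrev Rd (d : ℕ) : Type := EuclideanSpace ℝ (Fin d)

/-- The closed unit cube `[0,1]ᵈ`. -/
def unitCube (d : ℕ) : Set (Rd d) := {x | ∀ i, x i ∈ Set.Icc (0 : ℝ) 1}

/-! ### Flow and invariance -/

/-- A measurable flow on `Ω` indexed by `ℝᵈ`. -/
structure IsMeasurableFlow {d : ℕ} {Ω : Type*} [MeasurableSpace Ω] (θ : Rd d → Ω → Ω) : Prop where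
  measurable : Measurable (fun p : Ω × Rd d => θ p.2 p.1)
  zero : ∀ ω, θ 0 ω = ω
  add : ∀ x y ω, θ x (θ y ω) = θ (x + y) ω

/-- A random measure is invariant if `Φ(ω, B + x) = Φ(θₓ ω, B)`. -/
def IsInvariantMeasure {d : ℕ} {Ω : Type*} (θ : Rd d → Ω → Ω) (Φ : Ω → Measure (Rd d)) : Prop :=
  ∀ (ω : Ω) (x : Rd d) (B : Set (Rd d)), MeasurableSet B →
    Φ ω ((fun y => y + x) '' B) = Φ (θ x ω) B

/-- A kernel from `Ω × ℝᵈ` to `ℝᵈ` is invariant if `K(ω, x, B + x) = K(θₓ ω, 0, B)`. -/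
def IsInvariantKernel {d : ℕ} {Ω : Type*} (θ : Rd d → Ω → Ω)
    (K : Ω × Rd d → Measure (Rd d)) : Prop :=
  ∀ (ω : Ω) (x : Rd d) (B : Set (Rd d)), MeasurableSet B →
    K (ω, x) ((fun y => y + x) '' B) = K (θ x ω, 0) B

/-! ### Moment measures of a random measure -/

/-- The intensity `𝔼 Ψ([0,1]ᵈ)`. -/
def intensity {d : ℕ} {Ω : Type*} [MeasurableSpace Ω] (P : Measure Ω)
    (Ψ : Ω → Measure (Rd d)) : ℝ≥0∞ :=
  ∫⁻ ω, Ψ ω (unitCube d) ∂P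

/-- Local square-integrability: `𝔼 Ψ(B)² < ∞` for all bounded Borel sets `B`. -/
def IsLocallySquareIntegrable {d : ℕ} {Ω : Type*} [MeasurableSpace Ω] (P : Measure Ω)
    (Ψ : Ω → Measure (Rd d)) : Prop :=
  ∀ B : Set (Rd d), MeasurableSet B → Bornology.IsBounded B → ∫⁻ ω, Ψ ω B ^ 2 ∂P < ∞

/-- The reduced second moment measure
`α_Ψ(B) = 𝔼 ∫ 1{x ∈ [0,1]ᵈ, y - x ∈ B} Ψ²(d(x,y))`. -/
def reducedSecondMoment {d : ℕ} {Ω : Type*} [MeasurableSpace Ω] (P : Measure Ω)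
    (Ψ : Ω → Measure (Rd d)) : Measure (Rd d) :=
  P.bind fun ω =>
    (((Ψ ω).prod (Ψ ω)).restrict (unitCube d ×ˢ Set.univ)).map (fun p => p.2 - p.1)

/-- The integral `∫ h dβ_Ψ` with respect to the covariance measure `β_Ψ = α_Ψ - γ² λ_d`,
for bounded measurable functions `h` with bounded support (`γ` is the intensity of `Ψ`). -/
def covarianceIntegral {d : ℕ} {Ω : Type*} [MeasurableSpace Ω] (P : Measure Ω)
    (Ψ : Ω → Measure (Rd d)) (h : Rd d → ℝ) : ℝ :=
  (∫ y, h y ∂(reducedSecondMoment P Ψ)) - (intensity P Ψ).toReal ^ 2 * ∫ y, h y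

/-! ### Fourier transforms and the Bartlett spectral measure -/

/-- The Fourier transform `∫ exp(-i⟨k,x⟩) f(x) dx` of a function. -/
def fourierFun {d : ℕ} (f : Rd d → ℝ) (k : Rd d) : ℂ :=
  ∫ x, Complex.exp (-(Complex.I * (inner ℝ k x : ℝ))) * (f x : ℂ)

/-- The Fourier transform `∫ exp(-i⟨k,x⟩) ν(dx)` of a finite measure. -/
def fourierMeas {d : ℕ} (ν : Measure (Rd d)) (k : Rd d) : ℂ :=
  ∫ x, Complex.exp (-(Complex.I * (inner ℝ k x : ℝ))) ∂ν

/-- The Fourier transform `∫ exp(-i⟨k,x⟩) ν(dx)` of a finite signed measure. -/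
def fourierSigned {d : ℕ} (ν : SignedMeasure (Rd d)) (k : Rd d) : ℂ :=
  fourierMeas ν.toJordanDecomposition.posPart k - fourierMeas ν.toJordanDecomposition.negPart k

/-- Bounded measurable functions with bounded support. -/
structure IsTestFunction {d : ℕ} (f : Rd d → ℝ) : Prop where
  measurable : Measurable f
  bounded : ∃ C : ℝ, ∀ x, |f x| ≤ C
  support : Bornology.IsBounded (Function.support f)

/-- The tilted convolution `(f ⋆ g)(y) = ∫ f(x) g(x - y) dx`. -/
def tiltedConv {d : ℕ} (f g : Rd d → ℝ) (y : Rd d) : ℝ :=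
  ∫ x, f x * g (x - y)

/-- `S` is the Bartlett spectral measure of the (stationary, locally square-integrable) random
measure `Ψ`: the locally finite measure which is the Fourier transform of the covariance
measure `β_Ψ`, that is
`∫ f ⋆ g dβ_Ψ = (2π)^(-d) ∫ f̂(k) conj(ĝ(k)) S(dk)`
for all bounded measurable `f, g` with bounded support. -/
structure IsBartlettSpectralMeasure {d : ℕ} {Ω : Type*} [MeasurableSpace Ω] (P : Measure Ω)
    (Ψ : Ω → Measure (Rd d)) (S : Measure (Rd d)) : Prop where
  locallyFinite : IsLocallyFiniteMeasure S
  integrable : ∀ f g : Rd d → ℝ, IsTestFunction f → IsTestFunction g →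
    Integrable (fun k => fourierFun f k * conj (fourierFun g k)) S
  spectral : ∀ f g : Rd d → ℝ, IsTestFunction f → IsTestFunction g →
    ((covarianceIntegral P Ψ (tiltedConv f g) : ℝ) : ℂ) =
      (((2 * Real.pi) ^ d : ℝ) : ℂ)⁻¹ * ∫ k, fourierFun f k * conj (fourierFun g k) ∂S

/-! ### Palm probabilities -/

/-- The Palm probability measure
`P₀(A) = γ⁻¹ ∬ 1{x ∈ [0,1]ᵈ, θₓ ω ∈ A} Φ(ω, dx) P(dω)`. -/
def palm {d : ℕ} {Ω : Type*} [MeasurableSpace Ω] (P : Measure Ω) (θ : Rd d → Ω → Ω)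
    (Φ : Ω → Measure (Rd d)) : Measure Ω :=
  (intensity P Φ)⁻¹ • P.bind fun ω => ((Φ ω).restrict (unitCube d)).map (fun x => θ x ω)

/-- The probability kernel `Q` from `ℝᵈ` to `Ω` is (a version of) the two-point Palm
probabilities of `Φ`:
`𝔼 ∫ f(x, y, θ₀) Φ²(d(x,y)) = ∭ f(x, x + y, θ₋ₓ ω) Q(y, dω) α_Φ(dy) dx`
for all measurable `f ≥ 0`. -/
def IsTwoPointPalm {d : ℕ} {Ω : Type*} [MeasurableSpace Ω] (P : Measure Ω) (θ : Rd d → Ω → Ω)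
    (Φ : Ω → Measure (Rd d)) (Q : Kernel (Rd d) Ω) : Prop :=
  IsMarkovKernel Q ∧
  ∀ f : Rd d × Rd d × Ω → ℝ≥0∞, Measurable f →
    ∫⁻ ω, ∫⁻ x, ∫⁻ y, f (x, y, ω) ∂(Φ ω) ∂(Φ ω) ∂P =
      ∫⁻ x, ∫⁻ y, ∫⁻ ω, f (x, x + y, θ (-x) ω) ∂(Q y) ∂(reducedSecondMoment P Φ)

/-! ### Transports -/

/-- The destination `KΦ(ω, ·) = ∫ K(ω, x, ·) Φ(ω, dx)`. -/
def destination {d : ℕ} {Ω : Type*} (K : Ω × Rd d → Measure (Rd d)) (Φ : Ω → Measure (Rd d))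
    (ω : Ω) : Measure (Rd d) :=
  (Φ ω).bind fun x => K (ω, x)

/-- The relative displacement kernel `K*(ω, x, B) = K(ω, x, B + x)`. -/
def relDisplacement {d : ℕ} {Ω : Type*} (K : Ω × Rd d → Measure (Rd d)) (ω : Ω) (x : Rd d) :
    Measure (Rd d) :=
  (K (ω, x)).map (fun y => y - x)

/-- The mean relative displacement `L₀ = 𝔼₀[K*₀]` under the Palm probability measure. -/
def meanDisplacement {d : ℕ} {Ω : Type*} [MeasurableSpace Ω] (P : Measure Ω) (θ : Rd d → Ω → Ω)
    (Φ : Ω → Measure (Rd d)) (K : Ω × Rd d → Measure (Rd d)) : Measure (Rd d) :=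
  (palm P θ Φ).bind fun ω => relDisplacement K ω 0

/-- The non-random kernel `L(x, B) = L₀(B - x)` with `L₀ = 𝔼₀[K*₀]`. -/
def meanKernel {d : ℕ} {Ω : Type*} [MeasurableSpace Ω] (P : Measure Ω) (θ : Rd d → Ω → Ω)
    (Φ : Ω → Measure (Rd d)) (K : Ω × Rd d → Measure (Rd d)) (p : Ω × Rd d) : Measure (Rd d) :=
  (meanDisplacement P θ Φ K).map (fun z => z + p.2)

/-- The total variation norm `‖ν₁ - ν₂‖ = sup |∫ f dν₁ - ∫ f dν₂|` of a difference of finite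
measures, the supremum extending over all measurable `f` with values in `[-1,1]`. -/
def tvNormSub {X : Type*} [MeasurableSpace X] (ν₁ ν₂ : Measure X) : ℝ≥0∞ :=
  ⨆ (f : X → ℝ) (_ : Measurable f) (_ : ∀ x, f x ∈ Set.Icc (-1 : ℝ) 1),
    ENNReal.ofReal |(∫ x, f x ∂ν₁) - ∫ x, f x ∂ν₂|

/-- The mixing function `κ(y) = ‖𝔼_{0,y}[K*_y ⊗ K*_0] - (𝔼₀[K*₀])^{⊗ 2}‖`. -/
def mixingFunction {d : ℕ} {Ω : Type*} [MeasurableSpace Ω] (P : Measure Ω) (θ : Rd d → Ω → Ω)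
    (Φ : Ω → Measure (Rd d)) (Q : Kernel (Rd d) Ω) (K : Ω × Rd d → Measure (Rd d))
    (y : Rd d) : ℝ≥0∞ :=
  tvNormSub
    ((Q y).bind fun ω => (relDisplacement K ω y).prod (relDisplacement K ω 0))
    ((meanDisplacement P θ Φ K).prod (meanDisplacement P θ Φ K))

/-- `𝔼₀[K̂*₀(k)]`. -/
def palmFourier {d : ℕ} {Ω : Type*} [MeasurableSpace Ω] (P : Measure Ω) (θ : Rd d → Ω → Ω)
    (Φ : Ω → Measure (Rd d)) (K : Ω × Rd d → Measure (Rd d)) (k : Rd d) : ℂ :=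
  ∫ ω, fourierMeas (relDisplacement K ω 0) k ∂(palm P θ Φ)

/-- `e^{-i⟨k,y⟩} (𝔼_{0,y}[K̂*_y(k) conj(K̂*_0(k))] - |𝔼₀[K̂*₀(k)]|²)`. -/
def etaIntegrand {d : ℕ} {Ω : Type*} [MeasurableSpace Ω] (P : Measure Ω) (θ : Rd d → Ω → Ω)
    (Φ : Ω → Measure (Rd d)) (Q : Kernel (Rd d) Ω) (K : Ω × Rd d → Measure (Rd d))
    (k y : Rd d) : ℂ :=
  Complex.exp (-(Complex.I * (inner ℝ k y : ℝ))) *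
    ((∫ ω, fourierMeas (relDisplacement K ω y) k * conj (fourierMeas (relDisplacement K ω 0) k)
        ∂(Q y)) - ((‖palmFourier P θ Φ K k‖ ^ 2 : ℝ) : ℂ))

end

/-!
Given `ω`, two points of `Φ` with difference `y` are displaced independently of each other, so the
reduced second moment measure `α_{KΦ}` is the image of `α_Φ(dy) ⊗ E_{0,y}[K*_y ⊗ K*_0]` under the
map `(y, a, b) ↦ y + a - b`. For the non-random kernel `L` the second factor is the constant
measure `L₀ ⊗ L₀`. The difference of the two second factors is, measurably in `y`, a difference of
two finite measures whose total mass is at most the mixing function `κ(y)`. Composing with `α_Φ`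
gives finite measures `Np` and `Nm` on `ℝᵈ` with `α_{KΦ} + Nm = α_{LΦ} + Np`, so `η = Np - Nm` is
a finite signed measure, its Fourier transform is read off from this representation, and
`η̂(0) = Np(ℝᵈ) - Nm(ℝᵈ) = 0` since all the displacement kernels are Markov. As `LΦ` is locally
square-integrable by Jensen's inequality, so is `KΦ`
(`reducedSecondMoment_destination`, `exists_reducedSecondMoment_add_eq`).

For the spectral measure, `KΦ` and `LΦ` both have the intensity of `Φ`, so `β_{KΦ} = β_{LΦ} + η`.
A non-random displacement multiplies the spectral measure by `|L̂₀|²`, and by Parseval's identity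
the finite signed measure `η` contributes the density `η̂`, which is real since `α_{KΦ}` and
`α_{LΦ}` are symmetric
(`covarianceIntegral_translate`, `IsTestFunction.integral_tiltedConv_measure`). Hence the covariance
form of `KΦ` is the Fourier transform of the locally finite signed measure
`|L̂₀|² · β̂_Φ + η̂ · λ`. This signed measure is nonnegative because the covariance form, being the
variance of `∫ f dKΦ`, is positive semidefinite: if `S` and `T` are locally finite measures with
`∫ |f̂|² dT ≤ ∫ |f̂|² dS` for all test functions `f`, then `T ≤ S`. Indeed the transforms of test
functions are dense in `L²(S + T)`, since a function `v` orthogonal to those of all translates of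
`f` makes `conj(v) f̂ (S + T)` an integrable density with vanishing Fourier transform; so they
approximate the indicator of any bounded set. Uniqueness of the spectral measure follows from the
same comparison (`topologicalClosure_fourierTestSpan`, `measure_le_of_fourier_nonneg`,
`exists_isBartlettSpectralMeasure`).
-/

open scoped FourierTransform Topology
open Filter

/-! ### Characters and test functions -/

/-- The character `x ↦ exp(-i⟨k,x⟩)` through which all Fourier transforms are expressed. -/
noncomputable def expNegI {d : ℕ} (k x : Rd d) : ℂ :=
  Complex.exp (-(Complex.I * (inner ℝ k x : ℝ)))

section Characters

variable {d : ℕ}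

lemma norm_expNegI (k x : Rd d) : ‖expNegI k x‖ = 1 := by
  have : -(Complex.I * ((inner ℝ k x : ℝ) : ℂ)) = ((-(inner ℝ k x) : ℝ) : ℂ) * Complex.I := by
    push_cast; ring
  rw [expNegI, this, Complex.norm_exp_ofReal_mul_I]

lemma expNegI_add (k x y : Rd d) : expNegI k (x + y) = expNegI k x * expNegI k y := by
  simp only [expNegI, inner_add_right, ← Complex.exp_add]
  push_cast; ring_nf

lemma conj_expNegI (k x : Rd d) : conj (expNegI k x) = expNegI k (-x) := by
  simp [expNegI, ← Complex.exp_conj]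

lemma expNegI_sub (k x y : Rd d) : expNegI k (x - y) = expNegI k x * conj (expNegI k y) := by
  rw [sub_eq_add_neg, expNegI_add, conj_expNegI]

lemma expNegI_comm (k x : Rd d) : expNegI k x = expNegI x k := by
  simp [expNegI, real_inner_comm]

lemma expNegI_neg_left (k x : Rd d) : expNegI (-k) x = expNegI k (-x) := by
  simp [expNegI]

lemma expNegI_mul_conj (k x : Rd d) : expNegI k x * conj (expNegI k x) = 1 := by
  rw [← expNegI_sub]; simp [expNegI]

lemma continuous_expNegI : Continuous fun p : Rd d × Rd d => expNegI p.1 p.2 := by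
  unfold expNegI; fun_prop

lemma continuous_expNegI_right (k : Rd d) : Continuous fun x => expNegI k x :=
  continuous_expNegI.comp (by fun_prop : Continuous fun x : Rd d => (k, x))

lemma measurable_expNegI_comp {X : Type*} [MeasurableSpace X] {u v : X → Rd d}
    (hu : Measurable u) (hv : Measurable v) : Measurable fun x => expNegI (u x) (v x) :=
  Complex.measurable_exp.comp
    ((Complex.measurable_ofReal.comp (hu.inner hv)).const_mul Complex.I).neg

lemma integrable_expNegI {X : Type*} [MeasurableSpace X] (μ : Measure X) [IsFiniteMeasure μ]
    (k : Rd d) {u : X → Rd d} (hu : Measurable u) : Integrable (fun x => expNegI k (u x)) μ :=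
  Integrable.of_bound (measurable_expNegI_comp measurable_const hu).aestronglyMeasurable 1
    (ae_of_all _ fun _ => (norm_expNegI _ _).le)

/-- Multiplication by a character preserves integrability. -/
lemma Integrable.expNegI_mul {X : Type*} [MeasurableSpace X] {μ : Measure X} {u v : X → Rd d}
    (hu : Measurable u) (hv : Measurable v) {f : X → ℂ} (hf : Integrable f μ) :
    Integrable (fun x => expNegI (u x) (v x) * f x) μ :=
  hf.bdd_mul (measurable_expNegI_comp hu hv).aestronglyMeasurable
    (ae_of_all _ fun _ => (norm_expNegI _ _).le)

lemma fourierFun_eq (f : Rd d → ℝ) (k : Rd d) : fourierFun f k = ∫ x, expNegI k x * (f x : ℂ) := rfl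

lemma fourierMeas_eq (ν : Measure (Rd d)) (k : Rd d) : fourierMeas ν k = ∫ x, expNegI k x ∂ν := rfl

lemma fourierMeas_eq_charFun (ν : Measure (Rd d)) (k : Rd d) :
    fourierMeas ν k = charFun ν (-k) := by
  rw [fourierMeas, charFun_apply]
  congr 1 with x
  rw [real_inner_comm]
  simp [mul_comm]

lemma conj_fourierMeas (ν : Measure (Rd d)) (k : Rd d) :
    conj (fourierMeas ν k) = fourierMeas ν (-k) := by
  rw [fourierMeas_eq_charFun, fourierMeas_eq_charFun, charFun_neg, charFun_neg]; simp

lemma continuous_fourierMeas (ν : Measure (Rd d)) [IsFiniteMeasure ν] :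
    Continuous (fourierMeas ν) := by
  refine continuous_of_dominated (bound := fun _ => 1)
    (fun k => (continuous_expNegI_right k).aestronglyMeasurable)
    (fun k => ae_of_all _ fun x => (norm_expNegI k x).le) (integrable_const _)
    (ae_of_all _ fun x => ?_)
  exact continuous_expNegI.comp (by fun_prop : Continuous fun k : Rd d => (k, x))

lemma norm_fourierMeas_le (ν : Measure (Rd d)) (k : Rd d) :
    ‖fourierMeas ν k‖ ≤ ν.real Set.univ := by
  rw [fourierMeas_eq_charFun]; exact norm_charFun_le _

/-- The Fourier transform of `f(· + a)`. -/
lemma fourierFun_translate (f : Rd d → ℝ) (a k : Rd d) :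
    fourierFun (fun x => f (x + a)) k = conj (expNegI k a) * fourierFun f k := by
  rw [fourierFun_eq, fourierFun_eq, ← integral_const_mul, ← integral_add_right_eq_self
    (fun x => conj (expNegI k a) * (expNegI k x * (f x : ℂ))) a]
  congr 1 with x
  rw [expNegI_add]
  linear_combination (-expNegI k x * f (x + a)) * expNegI_mul_conj k a

lemma fourierFun_eq_fourier (f : Rd d → ℝ) (k : Rd d) :
    fourierFun f k = 𝓕 (fun x => (f x : ℂ)) ((2 * Real.pi)⁻¹ • k) := by
  rw [Real.fourier_eq', fourierFun]
  congr 1 with x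
  rw [smul_eq_mul]
  congr 2
  rw [inner_smul_right, real_inner_comm]
  push_cast
  field_simp

end Characters

namespace IsTestFunction

variable {d : ℕ} {f g : Rd d → ℝ}

/-- A test function is dominated by a multiple of the indicator of a closed ball. -/
lemma exists_bound (hf : IsTestFunction f) :
    ∃ C R : ℝ, 0 ≤ C ∧ (∀ x, |f x| ≤ C) ∧ ∀ x, f x ≠ 0 → ‖x‖ ≤ R := by
  obtain ⟨C, hC⟩ := hf.bounded
  obtain ⟨R, hR⟩ := hf.support.subset_closedBall 0
  refine ⟨C, R, (abs_nonneg _).trans (hC 0), hC, fun x hx => ?_⟩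
  simpa using hR (Function.mem_support.2 hx)

lemma memLp (hf : IsTestFunction f) (p : ℝ≥0∞) (μ : Measure (Rd d)) [IsLocallyFiniteMeasure μ] :
    MemLp f p μ := by
  obtain ⟨C, R, hC0, hC, hR⟩ := hf.exists_bound
  refine MemLp.mono (memLp_indicator_const (μ := μ) p
    (Metric.isClosed_closedBall (x := (0 : Rd d)) (ε := R)).measurableSet C
    (Or.inr (isCompact_closedBall 0 R).measure_lt_top.ne)) hf.measurable.aestronglyMeasurable
    (ae_of_all _ fun x => ?_)
  by_cases hx : f x = 0
  · simp [hx]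
  · rw [Set.indicator_of_mem (by simpa using hR x hx), Real.norm_eq_abs, Real.norm_eq_abs,
      abs_of_nonneg hC0]
    exact hC x

lemma integrable (hf : IsTestFunction f) (μ : Measure (Rd d)) [IsLocallyFiniteMeasure μ] :
    Integrable f μ := memLp_one_iff_integrable.1 (hf.memLp 1 μ)

lemma translate (hf : IsTestFunction f) (a : Rd d) : IsTestFunction fun x => f (x + a) where
  measurable := hf.measurable.comp (by fun_prop)
  bounded := hf.bounded.imp fun C hC x => hC _
  support := by
    obtain ⟨C, R, -, -, hR⟩ := hf.exists_bound
    refine (Metric.isBounded_closedBall (x := (0 : Rd d)) (r := R + ‖a‖)).subset fun x hx => ?_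
    have h1 := hR _ hx
    have h2 : ‖x‖ ≤ ‖x + a‖ + ‖a‖ := by simpa using norm_sub_le (x + a) a
    simp only [Metric.mem_closedBall, dist_zero_right]
    linarith

lemma add (hf : IsTestFunction f) (hg : IsTestFunction g) :
    IsTestFunction (fun x => f x + g x) where
  measurable := hf.measurable.add hg.measurable
  bounded := by
    obtain ⟨C, hC⟩ := hf.bounded
    obtain ⟨D, hD⟩ := hg.bounded
    exact ⟨C + D, fun x => (abs_add_le _ _).trans (add_le_add (hC x) (hD x))⟩
  support := (hf.support.union hg.support).subset (Function.support_add _ _)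

lemma const_mul (hf : IsTestFunction f) (c : ℝ) : IsTestFunction (fun x => c * f x) where
  measurable := hf.measurable.const_mul c
  bounded := by
    obtain ⟨C, hC⟩ := hf.bounded
    exact ⟨|c| * C, fun x => by rw [abs_mul]; gcongr; exact hC x⟩
  support := hf.support.subset fun x hx => by
    simp only [Function.mem_support] at hx ⊢
    exact right_ne_zero_of_mul hx

lemma indicator_one {s : Set (Rd d)} (hs : MeasurableSet s) (hb : Bornology.IsBounded s) :
    IsTestFunction (s.indicator fun _ => (1 : ℝ)) where
  measurable := measurable_const.indicator hs
  bounded := ⟨1, fun x => by by_cases h : x ∈ s <;> simp [h]⟩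
  support := hb.subset Set.support_indicator_subset

lemma integrable_ofReal (hf : IsTestFunction f) : Integrable (fun x => (f x : ℂ)) :=
  (hf.integrable volume).ofReal

lemma integrable_expNegI_mul (hf : IsTestFunction f) (k : Rd d) :
    Integrable (fun x => expNegI k x * (f x : ℂ)) :=
  Integrable.expNegI_mul measurable_const measurable_id hf.integrable_ofReal

lemma fourierFun_add (hf : IsTestFunction f) (hg : IsTestFunction g) (k : Rd d) :
    fourierFun (fun x => f x + g x) k = fourierFun f k + fourierFun g k := by
  rw [fourierFun_eq, fourierFun_eq, fourierFun_eq,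
    ← integral_add (hf.integrable_expNegI_mul k) (hg.integrable_expNegI_mul k)]
  congr 1 with x
  push_cast; ring

lemma continuous_fourierFun (hf : IsTestFunction f) : Continuous (fourierFun f) := by
  refine continuous_of_dominated (bound := fun x => |f x|)
    (fun k => (hf.integrable_expNegI_mul k).aestronglyMeasurable)
    (fun k => ae_of_all _ fun x => ?_) (hf.integrable volume).abs
    (ae_of_all _ fun x => ?_)
  · change ‖expNegI k x * (f x : ℂ)‖ ≤ _
    rw [norm_mul, norm_expNegI]; simp
  · exact (continuous_expNegI.comp (by fun_prop : Continuous fun k : Rd d => (k, x))).mul_const _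

end IsTestFunction

lemma fourierFun_const_mul {d : ℕ} (f : Rd d → ℝ) (c : ℝ) (k : Rd d) :
    fourierFun (fun x => c * f x) k = c * fourierFun f k := by
  rw [fourierFun_eq, fourierFun_eq, ← integral_const_mul]
  congr 1 with x
  push_cast; ring

/-- The Fourier transform of the indicator of the ball of radius `r` about the origin has no zero
in the ball of radius `r⁻¹`: on this range the cosine in its real part is at least `1/2`. -/
lemma fourierFun_ball_ne_zero {d : ℕ} {r : ℝ} (hr : 0 < r) {k : Rd d} (hk : ‖k‖ ≤ r⁻¹) :
    fourierFun ((Metric.ball (0 : Rd d) r).indicator fun _ => (1 : ℝ)) k ≠ 0 := by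
  have hf : IsTestFunction ((Metric.ball (0 : Rd d) r).indicator fun _ => (1 : ℝ)) :=
    .indicator_one measurableSet_ball Metric.isBounded_ball
  intro h0
  have hre : (fourierFun ((Metric.ball (0 : Rd d) r).indicator fun _ => (1 : ℝ)) k).re =
      ∫ x in Metric.ball (0 : Rd d) r, Real.cos (inner ℝ k x) := by
    rw [fourierFun_eq]
    have := integral_re (hf.integrable_expNegI_mul k)
    simp only [RCLike.re_to_complex] at this
    rw [← this, ← integral_indicator measurableSet_ball]
    congr 1 with x
    by_cases hx : x ∈ Metric.ball (0 : Rd d) r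
    · simp [hx, expNegI, Complex.exp_re]
    · simp [hx]
  have hge : (1 / 2 : ℝ) * volume.real (Metric.ball (0 : Rd d) r) ≤
      ∫ x in Metric.ball (0 : Rd d) r, Real.cos (inner ℝ k x) := by
    have hfin : IsFiniteMeasure (volume.restrict (Metric.ball (0 : Rd d) r)) :=
      ⟨by simpa using Metric.isBounded_ball.measure_lt_top⟩
    calc (1 / 2 : ℝ) * volume.real (Metric.ball (0 : Rd d) r)
        = ∫ x in Metric.ball (0 : Rd d) r, (1 / 2 : ℝ) := by simp [mul_comm]
      _ ≤ _ := by
        refine setIntegral_mono_on (integrable_const _) ?_ measurableSet_ball fun x hx => ?_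
        · exact Integrable.of_bound (by fun_prop) 1 (ae_of_all _ fun x => by
            simpa using Real.abs_cos_le_one _)
        · have hx' : ‖x‖ ≤ r := (by simpa using hx : ‖x‖ < r).le
          have h1 : |inner ℝ k x| ≤ 1 := by
            refine (abs_real_inner_le_norm k x).trans ?_
            calc ‖k‖ * ‖x‖ ≤ r⁻¹ * r := by gcongr
              _ = 1 := inv_mul_cancel₀ hr.ne'
          have h2 := Real.one_sub_sq_div_two_le_cos (x := inner ℝ k x)
          have h3 : (inner ℝ k x : ℝ) ^ 2 ≤ 1 := by
            rw [← sq_abs]; exact pow_le_one₀ (abs_nonneg _) h1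
          linarith
  have hpos : 0 < volume.real (Metric.ball (0 : Rd d) r) :=
    ENNReal.toReal_pos (Metric.measure_ball_pos _ _ hr).ne' Metric.isBounded_ball.measure_lt_top.ne
  rw [h0] at hre
  simp only [Complex.zero_re] at hre
  linarith

/-! ### The tilted convolution of two test functions -/

namespace IsTestFunction

variable {d : ℕ} {f g : Rd d → ℝ}

/-- Translation is continuous in `L²`, so that `f ⋆ g` is a continuous function. -/
lemma continuous_tiltedConv (hf : IsTestFunction f) (hg : IsTestFunction g) :
    Continuous (tiltedConv f g) := by
  let τ : Rd d → C(Rd d, Rd d) := fun y => ⟨fun x => x - y, by fun_prop⟩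
  have hτ : Continuous τ :=
    (ContinuousMap.mk (fun p : Rd d × Rd d => p.2 - p.1) (by fun_prop)).curry.continuous
  have hτm : ∀ y, MeasurePreserving (τ y) (volume : Measure (Rd d)) volume :=
    fun y => measurePreserving_sub_right volume y
  let F : Lp ℝ 2 (volume : Measure (Rd d)) := (hf.memLp 2 volume).toLp f
  let G : Lp ℝ 2 (volume : Measure (Rd d)) := (hg.memLp 2 volume).toLp g
  have hc : Continuous fun y => Lp.compMeasurePreserving (τ y) (hτm y) G :=
    Continuous.compMeasurePreservingLp continuous_const hτ hτm (by simp)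
  have heq : tiltedConv f g = fun y => inner ℝ (Lp.compMeasurePreserving (τ y) (hτm y) G) F := by
    ext y
    rw [L2.inner_def, tiltedConv]
    refine integral_congr_ae ?_
    have h1 := Lp.coeFn_compMeasurePreserving G (hτm y)
    have h2 := (hτm y).quasiMeasurePreserving.ae_eq_comp (hg.memLp 2 volume).coeFn_toLp
    have h3 := (hf.memLp 2 volume).coeFn_toLp
    filter_upwards [h1, h2, h3] with x h1 h2 h3
    rw [h1]
    simp only [Function.comp_apply] at h2 ⊢
    change _ = inner ℝ (((hg.memLp 2 volume).toLp g) ((τ y) x)) (((hf.memLp 2 volume).toLp f) x)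
    rw [h2, h3]
    simp [τ]
  rw [heq]
  exact hc.inner continuous_const

/-- The kernel of the tilted convolution is integrable on the product space. -/
lemma integrable_mul_sub (hf : IsTestFunction f) (hg : IsTestFunction g) :
    Integrable (fun p : Rd d × Rd d => f p.1 * g (p.1 - p.2)) (volume.prod volume) := by
  obtain ⟨C, R, hC0, hC, hR⟩ := hf.exists_bound
  obtain ⟨D, T, hD0, hD, hT⟩ := hg.exists_bound
  have hbig : Integrable ((Metric.closedBall (0 : Rd d) R ×ˢ
      Metric.closedBall (0 : Rd d) (R + T)).indicator fun _ => C * D)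
      ((volume : Measure (Rd d)).prod volume) := by
    rw [integrable_indicator_iff
      (Metric.isClosed_closedBall.measurableSet.prod Metric.isClosed_closedBall.measurableSet)]
    refine integrableOn_const ?_
    rw [Measure.prod_prod]
    exact ENNReal.mul_ne_top (isCompact_closedBall _ _).measure_lt_top.ne
      (isCompact_closedBall _ _).measure_lt_top.ne
  have hm : Measurable fun p : Rd d × Rd d => f p.1 * g (p.1 - p.2) :=
    (hf.measurable.comp measurable_fst).mul
      (hg.measurable.comp (measurable_fst.sub measurable_snd))
  refine hbig.mono hm.aestronglyMeasurable (ae_of_all _ fun p => ?_)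
  by_cases h0 : f p.1 * g (p.1 - p.2) = 0
  · simp [h0]
  · have h1 := hR _ (left_ne_zero_of_mul h0)
    have h2 := hT _ (right_ne_zero_of_mul h0)
    have h3 : ‖p.2‖ ≤ ‖p.1‖ + ‖p.1 - p.2‖ := by simpa using norm_sub_le p.1 (p.1 - p.2)
    have hmem : p ∈ Metric.closedBall (0 : Rd d) R ×ˢ Metric.closedBall (0 : Rd d) (R + T) :=
      ⟨by simpa using h1, by simpa using h3.trans (add_le_add h1 h2)⟩
    rw [Set.indicator_of_mem hmem,
      norm_mul, Real.norm_eq_abs, Real.norm_eq_abs, Real.norm_eq_abs,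
      abs_of_nonneg (mul_nonneg hC0 hD0)]
    exact mul_le_mul (hC _) (hD _) (abs_nonneg _) hC0

lemma conv (hf : IsTestFunction f) (hg : IsTestFunction g) :
    IsTestFunction (tiltedConv f g) where
  measurable := (hf.continuous_tiltedConv hg).measurable
  bounded := by
    obtain ⟨D, hD⟩ := hg.bounded
    refine ⟨(∫ x, |f x|) * D, fun y => ?_⟩
    rw [tiltedConv, ← integral_mul_const]
    refine norm_integral_le_of_norm_le (f := fun x => f x * g (x - y))
      ((hf.integrable volume).abs.mul_const D) (ae_of_all _ fun x => ?_)
    rw [norm_mul]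
    exact mul_le_mul_of_nonneg_left (hD _) (norm_nonneg _)
  support := by
    obtain ⟨C, R, hC0, hC, hR⟩ := hf.exists_bound
    obtain ⟨D, T, hD0, hD, hT⟩ := hg.exists_bound
    refine (Metric.isBounded_closedBall (x := (0 : Rd d)) (r := R + T)).subset fun y hy => ?_
    by_contra hy'
    refine hy ?_
    rw [tiltedConv]
    refine integral_eq_zero_of_ae (ae_of_all _ fun x => ?_)
    by_contra h0
    have h1 := hR _ (left_ne_zero_of_mul h0)
    have h2 := hT _ (right_ne_zero_of_mul h0)
    have h3 : ‖y‖ ≤ ‖x‖ + ‖x - y‖ := by simpa using norm_sub_le x (x - y)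
    exact hy' (by simpa using h3.trans (add_le_add h1 h2))

lemma integral_tiltedConv (hf : IsTestFunction f) (hg : IsTestFunction g) :
    ∫ y, tiltedConv f g y = (∫ x, f x) * ∫ x, g x := by
  simp only [tiltedConv]
  rw [← integral_integral_swap (hf.integrable_mul_sub hg), ← integral_mul_const]
  congr 1 with x
  rw [integral_const_mul, integral_sub_left_eq_self]

lemma fourierFun_tiltedConv (hf : IsTestFunction f) (hg : IsTestFunction g) (k : Rd d) :
    fourierFun (tiltedConv f g) k = fourierFun f k * conj (fourierFun g k) := by
  have hint : Integrable (Function.uncurry fun x y : Rd d =>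
      expNegI k y * ((f x * g (x - y) : ℝ) : ℂ)) (volume.prod volume) :=
    Integrable.expNegI_mul measurable_const measurable_snd
      (hf.integrable_mul_sub hg).ofReal
  have h1 : fourierFun (tiltedConv f g) k =
      ∫ y, ∫ x, expNegI k y * ((f x * g (x - y) : ℝ) : ℂ) := by
    rw [fourierFun_eq]
    congr 1 with y
    rw [integral_const_mul, integral_complex_ofReal, tiltedConv]
  rw [h1, ← integral_integral_swap hint, fourierFun_eq f, ← integral_mul_const]
  congr 1 with x
  have h2 : conj (fourierFun g k) = ∫ z, conj (expNegI k z) * (g z : ℂ) := by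
    rw [fourierFun_eq, ← integral_conj]
    simp
  rw [h2, ← integral_const_mul, ← integral_sub_left_eq_self _ volume x]
  congr 1 with y
  rw [sub_sub_cancel, expNegI_sub]
  push_cast
  ring

/-- Fourier transforms of test functions are square-integrable: the integrals of
`|f̂|² = (f ⋆ f)^` against flatter and flatter Gaussians stay bounded, as they converge to
`(f ⋆ f)(0)`. -/
lemma integrable_normSq_fourier (hf : IsTestFunction f) :
    Integrable (𝓕 fun x => ((tiltedConv f f x : ℝ) : ℂ)) := by
  set h : Rd d → ℂ := fun x => ((tiltedConv f f x : ℝ) : ℂ) with hh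
  have hcont : Continuous h := Complex.continuous_ofReal.comp (hf.continuous_tiltedConv hf)
  have hint : Integrable h := (hf.conv hf).integrable_ofReal
  have hF : ∀ w, 𝓕 h w = ((‖𝓕 h w‖ : ℝ) : ℂ) := fun w => by
    have h1 := hf.fourierFun_tiltedConv hf ((2 * Real.pi) • w)
    rw [fourierFun_eq_fourier (tiltedConv f f), smul_smul,
      inv_mul_cancel₀ (by positivity), one_smul, Complex.mul_conj] at h1
    rw [h1, Complex.norm_real, Real.norm_of_nonneg (Complex.normSq_nonneg _)]
  have hFc : Continuous (𝓕 h) := VectorFourier.fourierIntegral_continuous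
    Real.continuous_fourierChar continuous_inner hint
  have hlim := Real.tendsto_integral_gaussian_smul' hint (v := 0) hcont.continuousAt
  have hrepr : ∀ c : ℝ, 0 < c → ∫ w, (((Real.pi * c : ℂ) ^ (Module.finrank ℝ (Rd d) / 2 : ℂ) *
      Complex.exp (-Real.pi ^ 2 * c * ‖(0 : Rd d) - w‖ ^ 2)) • h w) =
      ((∫ w, Real.exp (-c⁻¹ * ‖w‖ ^ 2) * ‖𝓕 h w‖ : ℝ) : ℂ) := fun c hc => by
    have J : Integrable (fun w : Rd d => Complex.exp (-((c⁻¹ : ℝ) : ℂ) * ‖w‖ ^ 2 +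
        2 * Real.pi * Complex.I * (inner ℝ (0 : Rd d) w : ℝ))) :=
      GaussianFourier.integrable_cexp_neg_mul_sq_norm_add (by simpa using hc) _ _
    have h2 := VectorFourier.integral_fourierIntegral_smul_eq_flip (L := innerₗ (Rd d))
      Real.continuous_fourierChar continuous_inner J hint
    have h3 : ∀ w, VectorFourier.fourierIntegral Real.fourierChar volume (innerₗ (Rd d))
        (fun w : Rd d => Complex.exp (-((c⁻¹ : ℝ) : ℂ) * ‖w‖ ^ 2 +
        2 * Real.pi * Complex.I * (inner ℝ (0 : Rd d) w : ℝ))) w =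
        (Real.pi / ((c⁻¹ : ℝ) : ℂ)) ^ (Module.finrank ℝ (Rd d) / 2 : ℂ) *
          Complex.exp (-Real.pi ^ 2 * ‖(0 : Rd d) - w‖ ^ 2 / ((c⁻¹ : ℝ) : ℂ)) := fun w =>
      fourier_gaussian_innerProductSpace' (by simpa using hc) 0 w
    rw [← integral_complex_ofReal]
    refine Eq.trans ?_ (h2.trans ?_)
    · congr 1 with w
      rw [h3]
      congr 3
      · simp
      · simp; ring
    · congr 1 with w
      have h4 : VectorFourier.fourierIntegral Real.fourierChar volume (innerₗ (Rd d)).flip h w =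
          𝓕 h w := by
        rw [flip_innerₗ]; rfl
      rw [h4, hF w, Complex.ofReal_mul, Complex.norm_real, norm_norm, smul_eq_mul]
      congr 1
      push_cast
      simp
  have hlim2 : Tendsto (fun n : ℕ => ∫ w, Real.exp (-((n : ℝ) + 1)⁻¹ * ‖w‖ ^ 2) * ‖𝓕 h w‖) atTop
      (𝓝 (tiltedConv f f 0)) := by
    have h5 := (Complex.continuous_re.tendsto _).comp
      (hlim.comp (tendsto_natCast_atTop_atTop.atTop_add (tendsto_const_nhds (x := (1 : ℝ)))))
    refine h5.congr fun n => ?_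
    simp only [Function.comp_apply]
    rw [hrepr _ (by positivity), Complex.ofReal_re]
  refine ⟨hFc.aestronglyMeasurable, ?_⟩
  have hJ : ∀ n : ℕ, Integrable (fun w => Real.exp (-((n : ℝ) + 1)⁻¹ * ‖w‖ ^ 2) * ‖𝓕 h w‖) :=
    fun n => by
    have hg : Integrable (fun w : Rd d => Real.exp (-((n : ℝ) + 1)⁻¹ * ‖w‖ ^ 2)) := by
      have := GaussianFourier.integrable_cexp_neg_mul_sq_norm_add (V := Rd d)
        (b := ((((n : ℝ) + 1)⁻¹ : ℝ) : ℂ))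
        (by rw [Complex.ofReal_re]; positivity) 0 0
      have h6 := this.re
      refine h6.congr (ae_of_all _ fun w => ?_)
      simp only [zero_mul, add_zero]
      have : (-((((n : ℝ) + 1)⁻¹ : ℝ) : ℂ) * (‖w‖ : ℂ) ^ 2) =
        ((-((n : ℝ) + 1)⁻¹ * ‖w‖ ^ 2 : ℝ) : ℂ) := by push_cast; ring
      rw [this, ← Complex.ofReal_exp]
      rfl
    refine hg.mul_bdd (c := ∫ x, ‖h x‖) hFc.norm.aestronglyMeasurable (ae_of_all _ fun w => ?_)
    rw [norm_norm]
    exact VectorFourier.norm_fourierIntegral_le_integral_norm _ _ _ _ _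
  have hpt : ∀ w, Tendsto (fun n : ℕ =>
      ENNReal.ofReal (Real.exp (-((n : ℝ) + 1)⁻¹ * ‖w‖ ^ 2) * ‖𝓕 h w‖)) atTop
      (𝓝 ‖𝓕 h w‖ₑ) := fun w => by
    rw [← ofReal_norm]
    refine ENNReal.tendsto_ofReal ?_
    have h7 : Tendsto (fun n : ℕ => ((n : ℝ) + 1)⁻¹) atTop (𝓝 0) := by
      simpa using tendsto_one_div_add_atTop_nhds_zero_nat (𝕜 := ℝ)
    have h8 := ((h7.neg.mul_const (‖w‖ ^ 2)).rexp).mul_const ‖𝓕 h w‖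
    simpa using h8
  calc ∫⁻ w, ‖𝓕 h w‖ₑ = ∫⁻ w, liminf (fun n : ℕ =>
        ENNReal.ofReal (Real.exp (-((n : ℝ) + 1)⁻¹ * ‖w‖ ^ 2) * ‖𝓕 h w‖)) atTop := by
        congr 1 with w
        exact (hpt w).liminf_eq.symm
    _ ≤ liminf (fun n : ℕ => ∫⁻ w,
        ENNReal.ofReal (Real.exp (-((n : ℝ) + 1)⁻¹ * ‖w‖ ^ 2) * ‖𝓕 h w‖)) atTop :=
        lintegral_liminf_le fun n => by fun_prop
    _ = ENNReal.ofReal (tiltedConv f f 0) := by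
        refine ((ENNReal.tendsto_ofReal hlim2).congr fun n => ?_).liminf_eq
        exact ofReal_integral_eq_lintegral_ofReal (hJ n) (ae_of_all _ fun w => by positivity)
    _ < ∞ := ENNReal.ofReal_lt_top

lemma memLp_fourierFun (hf : IsTestFunction f) : MemLp (fourierFun f) 2 := by
  rw [memLp_two_iff_integrable_sq_norm hf.continuous_fourierFun.aestronglyMeasurable]
  have h1 := (hf.integrable_normSq_fourier.comp_smul
    (inv_ne_zero (by positivity : (2 * Real.pi) ≠ 0))).norm
  refine h1.congr (ae_of_all _ fun k => ?_)
  change ‖𝓕 (fun x => ((tiltedConv f f x : ℝ) : ℂ)) ((2 * Real.pi)⁻¹ • k)‖ = _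
  rw [← fourierFun_eq_fourier, hf.fourierFun_tiltedConv hf, norm_mul, RCLike.norm_conj, ← sq]

lemma integrable_fourierFun_mul_conj (hf : IsTestFunction f) (hg : IsTestFunction g) :
    Integrable fun k => fourierFun f k * conj (fourierFun g k) :=
  hf.memLp_fourierFun.integrable_mul hg.memLp_fourierFun.star

/-- Fourier inversion for `f ⋆ g`. -/
lemma tiltedConv_eq_integral (hf : IsTestFunction f) (hg : IsTestFunction g) (y : Rd d) :
    ((tiltedConv f g y : ℝ) : ℂ) = (((2 * Real.pi) ^ d : ℝ) : ℂ)⁻¹ *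
      ∫ k, expNegI k (-y) * (fourierFun f k * conj (fourierFun g k)) := by
  set h : Rd d → ℂ := fun x => ((tiltedConv f g x : ℝ) : ℂ) with hh
  have hcont : Continuous h := Complex.continuous_ofReal.comp (hf.continuous_tiltedConv hg)
  have hint : Integrable h := (hf.conv hg).integrable_ofReal
  have hpi : (2 * Real.pi) ≠ 0 := by positivity
  have heq : ∀ k, fourierFun f k * conj (fourierFun g k) = 𝓕 h ((2 * Real.pi)⁻¹ • k) := fun k => by
    rw [← hf.fourierFun_tiltedConv hg, fourierFun_eq_fourier]
  have hFint : Integrable (𝓕 h) := by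
    rw [← integrable_comp_smul_iff volume (𝓕 h) (inv_ne_zero hpi)]
    exact (hf.integrable_fourierFun_mul_conj hg).congr (ae_of_all _ heq)
  have hinv := hint.fourierInv_fourier_eq hFint (v := y) hcont.continuousAt
  change h y = _
  rw [← hinv, Real.fourierInv_eq']
  have h1 := Measure.integral_comp_smul_of_nonneg (volume : Measure (Rd d))
    (fun w => expNegI ((2 * Real.pi) • w) (-y) * 𝓕 h w) (2 * Real.pi)⁻¹ (hR := by positivity)
  have h2 : ∫ k, expNegI k (-y) * (fourierFun f k * conj (fourierFun g k)) =
      ∫ k, expNegI ((2 * Real.pi) • ((2 * Real.pi)⁻¹ • k)) (-y) * 𝓕 h ((2 * Real.pi)⁻¹ • k) := by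
    congr 1 with k
    rw [heq, smul_smul, mul_inv_cancel₀ hpi, one_smul]
  rw [h2, h1]
  have h3 : (((2 * Real.pi)⁻¹ : ℝ) ^ Module.finrank ℝ (Rd d))⁻¹ = (2 * Real.pi) ^ d := by
    rw [finrank_euclideanSpace_fin, inv_pow, inv_inv]
  rw [h3, Complex.real_smul, ← mul_assoc, inv_mul_cancel₀ (by
    exact_mod_cast pow_ne_zero d hpi), one_mul]
  congr 1 with w
  rw [smul_eq_mul, expNegI]
  congr 2
  rw [real_inner_smul_left, inner_neg_right]
  push_cast
  ring

/-- Parseval's formula for `f ⋆ g` and a finite measure. -/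
lemma integral_tiltedConv_measure (hf : IsTestFunction f) (hg : IsTestFunction g)
    (ν : Measure (Rd d)) [IsFiniteMeasure ν] :
    ((∫ y, tiltedConv f g y ∂ν : ℝ) : ℂ) = (((2 * Real.pi) ^ d : ℝ) : ℂ)⁻¹ *
      ∫ k, fourierMeas ν (-k) * (fourierFun f k * conj (fourierFun g k)) := by
  rw [← integral_complex_ofReal]
  simp_rw [hf.tiltedConv_eq_integral hg]
  rw [integral_const_mul]
  congr 1
  have hint : Integrable (Function.uncurry fun (y k : Rd d) =>
      expNegI k (-y) * (fourierFun f k * conj (fourierFun g k))) (ν.prod volume) :=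
    Integrable.expNegI_mul measurable_snd measurable_fst.neg
      ((hf.integrable_fourierFun_mul_conj hg).comp_snd ν)
  rw [integral_integral_swap hint]
  congr 1 with k
  rw [integral_mul_const, fourierMeas_eq]
  simp_rw [expNegI_neg_left]

end IsTestFunction

/-! ### Comparing measures through Fourier transforms of test functions -/

/-- A real integrable function all of whose trigonometric integrals vanish is zero: its positive
and negative parts are densities of two measures with the same characteristic function. -/
lemma ae_eq_zero_of_integral_expNegI_ofReal {d : ℕ} {m : Measure (Rd d)} {u : Rd d → ℝ}
    (hu : Integrable u m) (h : ∀ a, ∫ k, expNegI a k * (u k : ℂ) ∂m = 0) : u =ᵐ[m] 0 := by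
  have hfin : ∀ v : Rd d → ℝ, Integrable v m →
      IsFiniteMeasure (m.withDensity fun k => ENNReal.ofReal (v k)) := fun v hv =>
    isFiniteMeasure_withDensity_ofReal hv.2
  have := hfin u hu
  have := hfin _ hu.neg
  have hchar : ∀ v : Rd d → ℝ, Integrable v m → ∀ t,
      charFun (m.withDensity fun k => ENNReal.ofReal (v k)) (-t) =
        ∫ k, expNegI t k * ((max (v k) 0 : ℝ) : ℂ) ∂m := fun v hv t => by
    rw [← fourierMeas_eq_charFun, fourierMeas_eq,
      integral_withDensity_eq_integral_toReal_smul₀ hv.1.aemeasurable.ennreal_ofReal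
        (ae_of_all _ fun _ => ENNReal.ofReal_lt_top)]
    congr 1 with k
    rw [ENNReal.toReal_ofReal', Complex.real_smul, mul_comm]
  have hint : ∀ v : Rd d → ℝ, Integrable v m → ∀ t,
      Integrable (fun k => expNegI t k * ((max (v k) 0 : ℝ) : ℂ)) m := fun v hv t =>
    Integrable.expNegI_mul measurable_const measurable_id hv.pos_part.ofReal
  have heq : (m.withDensity fun k => ENNReal.ofReal (u k)) =
      m.withDensity fun k => ENNReal.ofReal ((-u) k) := by
    refine Measure.ext_of_charFun (funext fun t => ?_)
    rw [← neg_neg t, hchar u hu, hchar _ hu.neg, ← sub_eq_zero,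
      ← integral_sub (hint u hu _) (hint _ hu.neg _), ← h (-t)]
    congr 1 with k
    rw [← mul_sub, ← Complex.ofReal_sub]
    congr 2
    rcases le_total 0 (u k) with h0 | h0 <;> simp [h0]
  rw [withDensity_eq_iff hu.1.aemeasurable.ennreal_ofReal
    hu.neg.1.aemeasurable.ennreal_ofReal hu.lintegral_lt_top.ne] at heq
  filter_upwards [heq] with k hk
  have := congrArg ENNReal.toReal hk
  rw [ENNReal.toReal_ofReal', ENNReal.toReal_ofReal'] at this
  rcases le_total 0 (u k) with h0 | h0
  · simpa [h0] using this
  · simpa [h0] using this.symm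

/-- A complex integrable function all of whose trigonometric integrals vanish is zero. -/
lemma ae_eq_zero_of_integral_expNegI {d : ℕ} {m : Measure (Rd d)} {u : Rd d → ℂ}
    (hu : Integrable u m) (h : ∀ a, ∫ k, expNegI a k * u k ∂m = 0) : u =ᵐ[m] 0 := by
  have hconj : ∀ a, ∫ k, expNegI a k * conj (u k) ∂m = 0 := fun a => by
    have h1 := congrArg conj (h (-a))
    rw [← integral_conj, map_zero] at h1
    rw [← h1]
    congr 1 with k
    rw [map_mul, conj_expNegI, expNegI_neg_left, neg_neg]
  have hi : ∀ a, Integrable (fun k => expNegI a k * u k) m := fun a =>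
    Integrable.expNegI_mul measurable_const measurable_id hu
  have hi' : ∀ a, Integrable (fun k => expNegI a k * conj (u k)) m := fun a =>
    Integrable.expNegI_mul measurable_const measurable_id (Complex.conjLIE.integrable_comp_iff.2 hu)
  have hre : (fun k => (u k).re) =ᵐ[m] 0 := by
    refine ae_eq_zero_of_integral_expNegI_ofReal hu.re fun a => ?_
    have h2 : ∀ k, expNegI a k * (((u k).re : ℝ) : ℂ) =
        2⁻¹ * (expNegI a k * u k + expNegI a k * conj (u k)) := fun k => by
      rw [Complex.re_eq_add_conj]; ring
    simp_rw [h2]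
    rw [integral_const_mul, integral_add (hi a) (hi' a), h, hconj]; simp
  have him : (fun k => (u k).im) =ᵐ[m] 0 := by
    refine ae_eq_zero_of_integral_expNegI_ofReal hu.im fun a => ?_
    have h2 : ∀ k, expNegI a k * (((u k).im : ℝ) : ℂ) =
        (2 * Complex.I)⁻¹ * (expNegI a k * u k - expNegI a k * conj (u k)) := fun k => by
      rw [Complex.im_eq_sub_conj]; ring
    simp_rw [h2]
    rw [integral_const_mul, integral_sub (hi a) (hi' a), h, hconj]; simp
  filter_upwards [hre, him] with k h1 h2
  exact Complex.ext h1 h2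

/-- The complex span of the Fourier transforms of test functions, inside `L²(m)`. As real linear
combinations of test functions are test functions, its elements are those of the form
`f̂ + i ĝ`. -/
noncomputable def fourierTestSpan {d : ℕ} (m : Measure (Rd d)) : Submodule ℂ (Lp ℂ 2 m) where
  carrier := {u | ∃ f g : Rd d → ℝ, IsTestFunction f ∧ IsTestFunction g ∧
    u =ᵐ[m] fun k => fourierFun f k + Complex.I * fourierFun g k}
  add_mem' := by
    rintro u v ⟨f, g, hf, hg, hu⟩ ⟨f', g', hf', hg', hv⟩
    refine ⟨_, _, hf.add hf', hg.add hg', ?_⟩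
    filter_upwards [hu, hv, Lp.coeFn_add u v] with k h1 h2 h3
    rw [h3, Pi.add_apply, h1, h2, hf.fourierFun_add hf', hg.fourierFun_add hg']
    ring
  zero_mem' := by
    have h0 : IsTestFunction ((∅ : Set (Rd d)).indicator fun _ => (1 : ℝ)) :=
      .indicator_one MeasurableSet.empty Bornology.isBounded_empty
    refine ⟨_, _, h0, h0, ?_⟩
    filter_upwards [Lp.coeFn_zero ℂ 2 m] with k h
    rw [h]
    simp [fourierFun_eq]
  smul_mem' := by
    rintro c u ⟨f, g, hf, hg, hu⟩
    refine ⟨_, _, (hf.const_mul c.re).add (hg.const_mul (-c.im)),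
      (hf.const_mul c.im).add (hg.const_mul c.re), ?_⟩
    filter_upwards [hu, Lp.coeFn_smul c u] with k h1 h2
    rw [h2, Pi.smul_apply, h1, (hf.const_mul _).fourierFun_add (hg.const_mul _),
      (hf.const_mul _).fourierFun_add (hg.const_mul _)]
    simp only [fourierFun_const_mul, smul_eq_mul]
    conv_lhs => rw [← Complex.re_add_im c]
    push_cast
    linear_combination (-c.im * fourierFun g k) * Complex.I_sq * (-1)

/-- If all Fourier transforms of test functions are square-integrable with respect to `m`, then
they span a dense subspace of `L²(m)`. A function orthogonal to the transforms of all translates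
of the indicator of a small ball vanishes wherever the transform of that indicator does not. -/
lemma topologicalClosure_fourierTestSpan {d : ℕ} (m : Measure (Rd d))
    (hm : ∀ f : Rd d → ℝ, IsTestFunction f → MemLp (fourierFun f) 2 m) :
    (fourierTestSpan m).topologicalClosure = ⊤ := by
  rw [Submodule.topologicalClosure_eq_top_iff, Submodule.eq_bot_iff]
  intro v hv
  have key : ∀ f : Rd d → ℝ, IsTestFunction f → ∫ k, fourierFun f k * conj (v k) ∂m = 0 := by
    intro f hf
    have h0 : IsTestFunction ((∅ : Set (Rd d)).indicator fun _ => (1 : ℝ)) :=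
      .indicator_one MeasurableSet.empty Bornology.isBounded_empty
    have hmem : (hm f hf).toLp (fourierFun f) ∈ fourierTestSpan m := by
      refine ⟨f, _, hf, h0, ?_⟩
      filter_upwards [(hm f hf).coeFn_toLp] with k h
      rw [h]
      simp [fourierFun_eq]
    have h1 := (Submodule.mem_orthogonal' _ _).1 hv _ hmem
    rw [L2.inner_def] at h1
    rw [← h1]
    refine integral_congr_ae ?_
    filter_upwards [(hm f hf).coeFn_toLp] with k h
    rw [h]
    simp
  have hball : ∀ n : ℕ, ∀ᵐ k ∂m, ‖k‖ ≤ n + 1 → v k = 0 := by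
    intro n
    have hr : (0 : ℝ) < ((n : ℝ) + 1)⁻¹ := by positivity
    -- the transform of this indicator has no zero in the ball of radius `n + 1`
    have hf : IsTestFunction
        ((Metric.ball (0 : Rd d) ((n : ℝ) + 1)⁻¹).indicator fun _ => (1 : ℝ)) :=
      .indicator_one measurableSet_ball Metric.isBounded_ball
    have hint : Integrable (fun k => fourierFun
        ((Metric.ball (0 : Rd d) ((n : ℝ) + 1)⁻¹).indicator fun _ => (1 : ℝ)) k * conj (v k)) m :=
      (hm _ hf).integrable_mul (Lp.memLp v).star
    have hz := ae_eq_zero_of_integral_expNegI hint fun a => by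
      rw [← key _ (hf.translate (-a))]
      congr 1 with k
      rw [fourierFun_translate, conj_expNegI, neg_neg, expNegI_comm, mul_assoc]
    filter_upwards [hz] with k hk hkn
    have h2 := fourierFun_ball_ne_zero hr (k := k) (by rwa [inv_inv])
    simpa [h2] using hk
  rw [Lp.eq_zero_iff_ae_eq_zero]
  filter_upwards [ae_all_iff.2 hball] with k hk
  obtain ⟨n, hn⟩ := exists_nat_ge ‖k‖
  exact hk n (by linarith)

/-- Inequalities between measures can be tested on bounded sets. -/
lemma measure_le_of_forall_isBounded {d : ℕ} {μ ν : Measure (Rd d)}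
    (h : ∀ A : Set (Rd d), MeasurableSet A → Bornology.IsBounded A → μ A ≤ ν A) : μ ≤ ν := by
  refine Measure.le_iff.2 fun A hA => ?_
  have hlim : ∀ ρ : Measure (Rd d), Tendsto
      (fun n : ℕ => ρ (A ∩ Metric.closedBall 0 n)) atTop (𝓝 (ρ A)) := fun ρ => by
    have := tendsto_measure_iUnion_atTop (μ := ρ)
      (s := fun n : ℕ => A ∩ Metric.closedBall (0 : Rd d) n)
      (fun i j hij => Set.inter_subset_inter_right _ (Metric.closedBall_subset_closedBall
        (by exact_mod_cast hij)))
    rwa [← Set.inter_iUnion, Metric.iUnion_closedBall_nat, Set.inter_univ] at this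
  exact le_of_tendsto_of_tendsto' (hlim μ) (hlim ν) fun n =>
    h _ (hA.inter Metric.isClosed_closedBall.measurableSet)
      (Metric.isBounded_closedBall.subset Set.inter_subset_right)

/-- A spectral comparison principle. Suppose that `f, g ↦ ∫ f̂ ĝ* d(m₁ - m₂)` is real and
positive semidefinite on real test functions. Then `m₂ ≤ m₁`: the quadratic form is nonnegative on
complex test functions too, and their transforms approximate indicators of bounded sets in
`L²(m₁ + m₂)`. -/
theorem measure_le_of_fourier_nonneg {d : ℕ} {m₁ m₂ : Measure (Rd d)}
    [IsLocallyFiniteMeasure m₁] [IsLocallyFiniteMeasure m₂]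
    (h₁ : ∀ f g : Rd d → ℝ, IsTestFunction f → IsTestFunction g →
      Integrable (fun k => fourierFun f k * conj (fourierFun g k)) m₁)
    (h₂ : ∀ f g : Rd d → ℝ, IsTestFunction f → IsTestFunction g →
      Integrable (fun k => fourierFun f k * conj (fourierFun g k)) m₂)
    (C : (Rd d → ℝ) → (Rd d → ℝ) → ℝ)
    (hC : ∀ f g : Rd d → ℝ, IsTestFunction f → IsTestFunction g →
      (∫ k, fourierFun f k * conj (fourierFun g k) ∂m₁) -
        ∫ k, fourierFun f k * conj (fourierFun g k) ∂m₂ = (C f g : ℂ))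
    (hpos : ∀ f : Rd d → ℝ, IsTestFunction f → 0 ≤ C f f) : m₂ ≤ m₁ := by
  set m := m₁ + m₂ with hmdef
  have hm1 : m₁ ≤ m := Measure.le_add_right le_rfl
  have hm2 : m₂ ≤ m := Measure.le_add_left le_rfl
  have hmem : ∀ f : Rd d → ℝ, IsTestFunction f → MemLp (fourierFun f) 2 m := fun f hf => by
    rw [memLp_two_iff_integrable_sq_norm hf.continuous_fourierFun.aestronglyMeasurable]
    refine ((h₁ f f hf hf).add_measure (h₂ f f hf hf)).norm.congr (ae_of_all _ fun k => ?_)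
    simp only [norm_mul, RCLike.norm_conj]
    ring
  have hdense := topologicalClosure_fourierTestSpan m hmem
  -- the quadratic form on complex test functions
  have hquad : ∀ f g : Rd d → ℝ, IsTestFunction f → IsTestFunction g →
      eLpNorm (fun k => fourierFun f k + Complex.I * fourierFun g k) 2 m₂ ≤
        eLpNorm (fun k => fourierFun f k + Complex.I * fourierFun g k) 2 m₁ := by
    intro f g hf hg
    have hL : ∀ μ : Measure (Rd d), (∀ f g : Rd d → ℝ, IsTestFunction f → IsTestFunction g →
        Integrable (fun k => fourierFun f k * conj (fourierFun g k)) μ) →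
        Integrable (fun k => ‖fourierFun f k + Complex.I * fourierFun g k‖ ^ 2) μ ∧
        ((∫ k, ‖fourierFun f k + Complex.I * fourierFun g k‖ ^ 2 ∂μ : ℝ) : ℂ) =
          (∫ k, fourierFun f k * conj (fourierFun f k) ∂μ) +
          (∫ k, fourierFun g k * conj (fourierFun g k) ∂μ) +
          (Complex.I * (∫ k, fourierFun g k * conj (fourierFun f k) ∂μ) -
            Complex.I * ∫ k, fourierFun f k * conj (fourierFun g k) ∂μ) := fun μ hμ => by
      have hpt : ∀ k, ((‖fourierFun f k + Complex.I * fourierFun g k‖ ^ 2 : ℝ) : ℂ) =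
          fourierFun f k * conj (fourierFun f k) + fourierFun g k * conj (fourierFun g k) +
          (Complex.I * (fourierFun g k * conj (fourierFun f k)) -
            Complex.I * (fourierFun f k * conj (fourierFun g k))) := fun k => by
        rw [← Complex.normSq_eq_norm_sq, ← Complex.mul_conj]
        simp only [map_add, map_mul, Complex.conj_I]
        linear_combination (-(fourierFun g k * conj (fourierFun g k))) * Complex.I_sq
      have hi := ((hμ f f hf hf).add (hμ g g hg hg)).add
        (((hμ g f hg hf).const_mul Complex.I).sub ((hμ f g hf hg).const_mul Complex.I))
      constructor
      · refine hi.norm.congr (ae_of_all _ fun k => ?_)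
        have h := congrArg norm (hpt k)
        rw [Complex.norm_real, Real.norm_of_nonneg (by positivity)] at h
        exact h.symm
      · rw [← integral_complex_ofReal]
        simp_rw [hpt]
        refine (integral_add ((hμ f f hf hf).add (hμ g g hg hg)) (((hμ g f hg hf).const_mul _).sub
          ((hμ f g hf hg).const_mul _))).trans ?_
        refine congrArg₂ _ (integral_add (hμ f f hf hf) (hμ g g hg hg))
          ((integral_sub ((hμ g f hg hf).const_mul _) ((hμ f g hf hg).const_mul _)).trans ?_)
        rw [integral_const_mul, integral_const_mul]
    obtain ⟨hi1, he1⟩ := hL m₁ h₁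
    obtain ⟨hi2, he2⟩ := hL m₂ h₂
    -- the form is real, hence symmetric, so that the mixed terms cancel
    have hsym : C g f = C f g := by
      have h3 : ((C g f : ℝ) : ℂ) = conj ((C f g : ℝ) : ℂ) := by
        rw [← hC f g hf hg, ← hC g f hg hf, map_sub, ← integral_conj, ← integral_conj]
        simp [mul_comm]
      rw [Complex.conj_ofReal] at h3
      exact_mod_cast h3
    have hdiff : (∫ k, ‖fourierFun f k + Complex.I * fourierFun g k‖ ^ 2 ∂m₁) -
        (∫ k, ‖fourierFun f k + Complex.I * fourierFun g k‖ ^ 2 ∂m₂) = C f f + C g g := by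
      have h4 : (((∫ k, ‖fourierFun f k + Complex.I * fourierFun g k‖ ^ 2 ∂m₁) -
        (∫ k, ‖fourierFun f k + Complex.I * fourierFun g k‖ ^ 2 ∂m₂) : ℝ) : ℂ) =
          ((C f f + C g g : ℝ) : ℂ) := by
        rw [Complex.ofReal_sub, he1, he2, Complex.ofReal_add, ← hC f f hf hf, ← hC g g hg hg]
        have h5 := hC f g hf hg
        have h6 := hC g f hg hf
        rw [hsym] at h6
        linear_combination Complex.I * h6 - Complex.I * h5
      exact_mod_cast h4
    have hle : (∫ k, ‖fourierFun f k + Complex.I * fourierFun g k‖ ^ 2 ∂m₂) ≤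
        ∫ k, ‖fourierFun f k + Complex.I * fourierFun g k‖ ^ 2 ∂m₁ := by
      linarith [hpos f hf, hpos g hg]
    have hnorm : ∀ μ : Measure (Rd d),
        Integrable (fun k => ‖fourierFun f k + Complex.I * fourierFun g k‖ ^ 2) μ →
        eLpNorm (fun k => fourierFun f k + Complex.I * fourierFun g k) 2 μ =
        ENNReal.ofReal (∫ k, ‖fourierFun f k + Complex.I * fourierFun g k‖ ^ 2 ∂μ) ^ (1 / 2 : ℝ) :=
      fun μ hμ => by
      rw [eLpNorm_eq_lintegral_rpow_enorm_toReal two_ne_zero ENNReal.ofNat_ne_top,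
        ofReal_integral_eq_lintegral_ofReal hμ (ae_of_all _ fun k => by positivity)]
      simp only [ENNReal.toReal_ofNat]
      congr 2 with k
      rw [ENNReal.ofReal_pow (norm_nonneg _), ofReal_norm, ← ENNReal.rpow_natCast]
      norm_cast
    rw [hnorm _ hi1, hnorm _ hi2]
    gcongr
  have hbdd : ∀ A : Set (Rd d), MeasurableSet A → Bornology.IsBounded A → m₂ A ≤ m₁ A := by
    intro A hA hAb
    have hAm : MemLp (A.indicator fun _ => (1 : ℂ)) 2 m :=
      memLp_indicator_const 2 hA 1 (Or.inr (by
        rw [hmdef, Measure.add_apply]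
        exact ENNReal.add_ne_top.2 ⟨hAb.measure_lt_top.ne, hAb.measure_lt_top.ne⟩))
    set a : Lp ℂ 2 m := hAm.toLp _
    have ha : a ∈ closure (fourierTestSpan m : Set (Lp ℂ 2 m)) := by
      rw [← Submodule.topologicalClosure_coe, hdense]; trivial
    have hle : eLpNorm (A.indicator fun _ => (1 : ℂ)) 2 m₂ ≤
        eLpNorm (A.indicator fun _ => (1 : ℂ)) 2 m₁ := by
      refine ENNReal.le_of_forall_pos_le_add fun ε hε _ => ?_
      obtain ⟨u, ⟨f, g, hf, hg, hu⟩, hua⟩ := EMetric.mem_closure_iff.1 ha (ε / 2 : ℝ≥0∞)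
        (ENNReal.div_pos (by exact_mod_cast hε.ne') (by simp))
      set w : Rd d → ℂ := fun k => fourierFun f k + Complex.I * fourierFun g k with hw
      have hwc : Continuous w :=
        hf.continuous_fourierFun.add (continuous_const.mul hg.continuous_fourierFun)
      have hdist : eLpNorm ((A.indicator fun _ => (1 : ℂ)) - w) 2 m ≤ ε / 2 := by
        refine le_of_eq_of_le ?_ hua.le
        rw [Lp.edist_def]
        refine eLpNorm_congr_ae ?_
        filter_upwards [hu, hAm.coeFn_toLp] with k h1 h2
        rw [Pi.sub_apply, Pi.sub_apply, h1, h2]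
      have hAs : StronglyMeasurable (A.indicator fun _ => (1 : ℂ)) :=
        stronglyMeasurable_const.indicator hA
      calc eLpNorm (A.indicator fun _ => (1 : ℂ)) 2 m₂
          = eLpNorm (((A.indicator fun _ => (1 : ℂ)) - w) + w) 2 m₂ := by rw [sub_add_cancel]
        _ ≤ eLpNorm ((A.indicator fun _ => (1 : ℂ)) - w) 2 m₂ + eLpNorm w 2 m₂ :=
          eLpNorm_add_le (hAs.sub hwc.stronglyMeasurable).aestronglyMeasurable
            hwc.aestronglyMeasurable (by norm_num)
        _ ≤ ε / 2 + eLpNorm w 2 m₁ := by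
          exact add_le_add ((eLpNorm_mono_measure _ hm2).trans hdist) (hquad f g hf hg)
        _ ≤ ε / 2 + (eLpNorm (A.indicator fun _ => (1 : ℂ)) 2 m₁ + ε / 2) := by
          gcongr
          calc eLpNorm w 2 m₁ = eLpNorm ((A.indicator fun _ => (1 : ℂ)) -
                ((A.indicator fun _ => (1 : ℂ)) - w)) 2 m₁ := by rw [sub_sub_cancel]
            _ ≤ eLpNorm (A.indicator fun _ => (1 : ℂ)) 2 m₁ +
                eLpNorm ((A.indicator fun _ => (1 : ℂ)) - w) 2 m₁ :=
              eLpNorm_sub_le hAs.aestronglyMeasurable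
                (hAs.sub hwc.stronglyMeasurable).aestronglyMeasurable (by norm_num)
            _ ≤ _ := by gcongr; exact (eLpNorm_mono_measure _ hm1).trans hdist
        _ = eLpNorm (A.indicator fun _ => (1 : ℂ)) 2 m₁ + ε := by
          rw [add_left_comm, ENNReal.add_halves]
    rw [eLpNorm_indicator_const hA two_ne_zero ENNReal.ofNat_ne_top,
      eLpNorm_indicator_const hA two_ne_zero ENNReal.ofNat_ne_top] at hle
    simpa [ENNReal.rpow_le_rpow_iff (show (0 : ℝ) < 2⁻¹ by norm_num)] using hle
  exact measure_le_of_forall_isBounded hbdd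

/-- The Bartlett spectral measure is unique. -/
lemma IsBartlettSpectralMeasure.unique {d : ℕ} {Ω : Type*} [MeasurableSpace Ω] {P : Measure Ω}
    {Ψ : Ω → Measure (Rd d)} {S T : Measure (Rd d)} (hS : IsBartlettSpectralMeasure P Ψ S)
    (hT : IsBartlettSpectralMeasure P Ψ T) : S = T := by
  have := hS.locallyFinite
  have := hT.locallyFinite
  have heq : ∀ f g : Rd d → ℝ, IsTestFunction f → IsTestFunction g →
      ∫ k, fourierFun f k * conj (fourierFun g k) ∂S =
        ∫ k, fourierFun f k * conj (fourierFun g k) ∂T := fun f g hf hg => by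
    have h := (hS.spectral f g hf hg).symm.trans (hT.spectral f g hf hg)
    have h2 : (((2 * Real.pi) ^ d : ℝ) : ℂ)⁻¹ ≠ 0 :=
      inv_ne_zero (by exact_mod_cast (by positivity : (2 * Real.pi) ^ d ≠ 0))
    exact mul_left_cancel₀ h2 h
  refine le_antisymm ?_ ?_
  · exact measure_le_of_fourier_nonneg hT.integrable hS.integrable (fun _ _ => 0)
      (fun f g hf hg => by simp [heq f g hf hg]) fun _ _ => le_rfl
  · exact measure_le_of_fourier_nonneg hS.integrable hT.integrable (fun _ _ => 0)
      (fun f g hf hg => by simp [heq f g hf hg]) fun _ _ => le_rfl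

/-- A σ-finite measure dominated by another one can be subtracted from it. -/
lemma exists_measure_add_eq_of_le {X : Type*} [MeasurableSpace X] {μ ν : Measure X}
    [SigmaFinite μ] [SigmaFinite ν] (h : ν ≤ μ) : ∃ S : Measure X, S + ν = μ := by
  have hac : ν ≪ μ := Measure.absolutelyContinuous_of_le h
  have hle : ν.rnDeriv μ ≤ᵐ[μ] 1 := Measure.rnDeriv_le_one_of_le h
  refine ⟨μ.withDensity (1 - ν.rnDeriv μ), ?_⟩
  nth_rewrite 2 [← Measure.withDensity_rnDeriv_eq ν μ hac]
  rw [← withDensity_add_right _ (Measure.measurable_rnDeriv ν μ)]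
  conv_rhs => rw [← withDensity_one (μ := μ)]
  refine withDensity_congr_ae ?_
  filter_upwards [hle] with x hx
  exact tsub_add_cancel_of_le hx

/-! ### Kernels: s-finiteness, joint measurability, total variation -/

section KernelLemmas

variable {X Y Z : Type*} [MeasurableSpace X] [MeasurableSpace Y] [MeasurableSpace Z]

/-- A kernel with finite, not necessarily uniformly bounded, total masses is s-finite. -/
lemma isSFiniteKernel_of_forall_lt_top (κ : Kernel X Y) (h : ∀ x, κ x Set.univ < ∞) :
    IsSFiniteKernel κ := by
  have hA : ∀ n : ℕ, MeasurableSet {x | ⌊(κ x Set.univ).toReal⌋₊ = n} := fun n =>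
    (Nat.measurable_floor.comp (κ.measurable_coe MeasurableSet.univ).ennreal_toReal)
      (measurableSet_singleton n)
  have hsum : κ = Kernel.sum fun n => Kernel.piecewise (hA n) κ 0 := by
    ext x s hs
    rw [Kernel.sum_apply' _ _ hs, tsum_eq_single ⌊(κ x Set.univ).toReal⌋₊]
    · simp [Kernel.piecewise_apply']
    · intro n hn
      simp [Kernel.piecewise_apply', hn.symm]
  rw [hsum]
  refine @Kernel.isSFiniteKernel_sum _ _ _ _ _ _ _ fun n => ?_
  have : IsFiniteKernel (Kernel.piecewise (hA n) κ 0) := by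
    refine ⟨⟨ENNReal.ofReal (n + 1), ENNReal.ofReal_lt_top, fun x => ?_⟩⟩
    rw [Kernel.piecewise_apply']
    split_ifs with hx
    · rw [← ENNReal.ofReal_toReal (h x).ne]
      refine ENNReal.ofReal_le_ofReal ?_
      have hx' : ⌊(κ x Set.univ).toReal⌋₊ = n := hx
      rw [← hx']
      exact (Nat.lt_floor_add_one _).le
    · simp
  infer_instance

/-- A random measure with locally finite values is an s-finite kernel. -/
lemma isSFiniteKernel_of_isLocallyFiniteMeasure {d : ℕ} (Φ : Kernel X (Rd d))
    (h : ∀ x, IsLocallyFiniteMeasure (Φ x)) : IsSFiniteKernel Φ := by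
  let A : ℕ → Set (Rd d) := disjointed fun n => Metric.closedBall 0 n
  have hA : ∀ n, MeasurableSet (A n) :=
    MeasurableSet.disjointed fun n => Metric.isClosed_closedBall.measurableSet
  have hU : ⋃ n, A n = Set.univ := by
    rw [iUnion_disjointed, Metric.iUnion_closedBall_nat]
  have hsum : Φ = Kernel.sum fun n => Φ.restrict (hA n) := by
    ext1 x
    rw [Kernel.sum_apply]
    simp_rw [Kernel.restrict_apply]
    rw [← Measure.restrict_iUnion (disjoint_disjointed _) hA, hU, Measure.restrict_univ]
  rw [hsum]
  refine @Kernel.isSFiniteKernel_sum _ _ _ _ _ _ _ fun n =>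
    isSFiniteKernel_of_forall_lt_top _ fun x => ?_
  have := h x
  rw [Kernel.restrict_apply, Measure.restrict_apply MeasurableSet.univ, Set.univ_inter]
  exact (measure_mono (disjointed_subset _ n)).trans_lt Metric.isBounded_closedBall.measure_lt_top

lemma measurable_lintegral_kernel_comp (κ : Kernel Y Z) [IsSFiniteKernel κ] {g : X → Y}
    (hg : Measurable g) {f : X → Z → ℝ≥0∞} (hf : Measurable (Function.uncurry f)) :
    Measurable fun x => ∫⁻ z, f x z ∂(κ (g x)) :=
  Measurable.lintegral_kernel_prod_right (κ := κ.comap g hg) hf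

lemma measurable_map_kernel (κ : Kernel X Y) [IsSFiniteKernel κ] {φ : X → Y → Z}
    (hφ : Measurable (Function.uncurry φ)) : Measurable fun x => (κ x).map (φ x) := by
  refine Measure.measurable_of_measurable_coe _ fun s hs => ?_
  have h : ∀ x, (κ x).map (φ x) s = κ x (Prod.mk x ⁻¹' (Function.uncurry φ ⁻¹' s)) := fun x => by
    exact Measure.map_apply (hφ.comp measurable_prodMk_left : Measurable (φ x)) hs
  simp_rw [h]
  exact Kernel.measurable_kernel_prodMk_left (hφ hs)

/-- A Markov kernel `κ` and a probability measure `ν` differ by two mutually singular finite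
kernels whose total masses sum up to the total variation distance. The Hahn sets are chosen
measurably in the parameter, by means of densities with respect to `κ + ν`. -/
lemma exists_kernel_add_eq_add [MeasurableSpace.CountableOrCountablyGenerated X Y]
    (κ : Kernel X Y) [IsMarkovKernel κ] (ν : Measure Y) [IsProbabilityMeasure ν] :
    ∃ κp κm : Kernel X Y, IsFiniteKernel κp ∧ IsFiniteKernel κm ∧
      (∀ x, κ x + κm x = ν + κp x) ∧
      ∀ x, κp x Set.univ + κm x Set.univ ≤ tvNormSub (κ x) ν := by
  let η : Kernel X Y := Kernel.const X ν
  let τ : Kernel X Y := κ + η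
  let f := Kernel.rnDeriv κ τ
  let g := Kernel.rnDeriv η τ
  have hf : Measurable (Function.uncurry f) := Kernel.measurable_rnDeriv κ τ
  have hg : Measurable (Function.uncurry g) := Kernel.measurable_rnDeriv η τ
  have hκ : ∀ x, (τ x).withDensity (f x) = κ x := fun x => by
    have := Kernel.withDensity_rnDeriv_eq (κ := κ) (η := τ) (a := x)
      (Measure.absolutelyContinuous_of_le (Measure.le_add_right le_rfl))
    rwa [Kernel.withDensity_apply _ hf] at this
  have hη : ∀ x, (τ x).withDensity (g x) = ν := fun x => by
    have := Kernel.withDensity_rnDeriv_eq (κ := η) (η := τ) (a := x)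
      (Measure.absolutelyContinuous_of_le (Measure.le_add_left le_rfl))
    rwa [Kernel.withDensity_apply _ hg] at this
  have hfg : Measurable (Function.uncurry fun x y => f x y - g x y) := hf.sub hg
  have hgf : Measurable (Function.uncurry fun x y => g x y - f x y) := hg.sub hf
  have hfx : ∀ x, Measurable (f x) := fun x => hf.comp measurable_prodMk_left
  have hgx : ∀ x, Measurable (g x) := fun x => hg.comp measurable_prodMk_left
  let κp := Kernel.withDensity τ fun x y => f x y - g x y
  let κm := Kernel.withDensity τ fun x y => g x y - f x y
  have hκp : ∀ x, κp x = (τ x).withDensity (fun y => f x y - g x y) :=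
    fun x => Kernel.withDensity_apply _ hfg x
  have hκm : ∀ x, κm x = (τ x).withDensity (fun y => g x y - f x y) :=
    fun x => Kernel.withDensity_apply _ hgf x
  have hpf : ∀ x, κp x ≤ κ x := fun x => by
    rw [hκp, ← hκ]
    exact withDensity_mono (ae_of_all _ fun y => tsub_le_self)
  have hmf : ∀ x, κm x ≤ ν := fun x => by
    rw [hκm, ← hη x]
    exact withDensity_mono (ae_of_all _ fun y => tsub_le_self)
  have hadd : ∀ x, κ x + κm x = ν + κp x := fun x => by
    rw [hκp, hκm, ← hη x]
    nth_rewrite 1 [← hκ x]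
    rw [← withDensity_add_left (hfx x), ← withDensity_add_left (hgx x)]
    congr 1
    ext y
    simp only [Pi.add_apply]
    rcases le_total (f x y) (g x y) with h | h
    · rw [add_tsub_cancel_of_le h, tsub_eq_zero_of_le h, add_zero]
    · rw [add_tsub_cancel_of_le h, tsub_eq_zero_of_le h, add_zero]
  refine ⟨κp, κm, ⟨⟨1, ENNReal.one_lt_top, fun x => ?_⟩⟩, ⟨⟨1, ENNReal.one_lt_top, fun x => ?_⟩⟩,
    hadd, fun x => ?_⟩
  · exact (hpf x _).trans prob_le_one
  · exact (hmf x _).trans prob_le_one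
  have hfinp : IsFiniteMeasure (κp x) := ⟨((hpf x _).trans prob_le_one).trans_lt ENNReal.one_lt_top⟩
  have hfinm : IsFiniteMeasure (κm x) := ⟨((hmf x _).trans prob_le_one).trans_lt ENNReal.one_lt_top⟩
  let A : Set Y := {y | g x y < f x y}
  have hA : MeasurableSet A := measurableSet_lt (hgx x) (hfx x)
  have hmA : κm x A = 0 := by
    rw [hκm, withDensity_apply _ hA]
    refine setLIntegral_eq_zero hA fun y hy => ?_
    exact tsub_eq_zero_of_le (le_of_lt hy)
  have hpA : κp x Aᶜ = 0 := by
    rw [hκp, withDensity_apply _ hA.compl]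
    refine setLIntegral_eq_zero hA.compl fun y hy => ?_
    exact tsub_eq_zero_of_le (not_lt.1 hy)
  have hr : ∀ s, (κ x).real s + (κm x).real s = ν.real s + (κp x).real s := fun s => by
    rw [← measureReal_add_apply, ← measureReal_add_apply, hadd]
  have h1 := hr A
  have h2 := hr Aᶜ
  rw [measureReal_def (κm x), hmA] at h1
  rw [measureReal_def (κp x), hpA] at h2
  let s : Y → ℝ := A.indicator (fun _ => 1) - Aᶜ.indicator (fun _ => 1)
  have hs : Measurable s :=
    (measurable_const.indicator hA).sub (measurable_const.indicator hA.compl)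
  have hs1 : ∀ y, s y ∈ Set.Icc (-1 : ℝ) 1 := fun y => by
    by_cases hy : y ∈ A <;> simp [s, hy]
  have hsint : ∀ μ : Measure Y, IsFiniteMeasure μ → ∫ y, s y ∂μ = μ.real A - μ.real Aᶜ :=
    fun μ hμ => by
    simp only [s, Pi.sub_apply]
    rw [integral_sub ((integrable_const _).indicator hA) ((integrable_const _).indicator hA.compl),
      integral_indicator_const _ hA, integral_indicator_const _ hA.compl]
    simp
  have htot : (κp x Set.univ) + κm x Set.univ = ENNReal.ofReal
      |(∫ y, s y ∂(κ x)) - ∫ y, s y ∂ν| := by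
    rw [hsint _ inferInstance, hsint _ inferInstance]
    have hpu : (κp x).real Set.univ = (κp x).real A + (κp x).real Aᶜ :=
      (measureReal_add_measureReal_compl hA).symm
    have hmu : (κm x).real Set.univ = (κm x).real A + (κm x).real Aᶜ :=
      (measureReal_add_measureReal_compl hA).symm
    rw [measureReal_def _ Aᶜ, hpA] at hpu
    rw [measureReal_def _ A, hmA] at hmu
    simp only [ENNReal.toReal_zero] at h1 h2 hpu hmu
    have h3 : (κ x).real A - (κ x).real Aᶜ - (ν.real A - ν.real Aᶜ) =
        (κp x).real Set.univ + (κm x).real Set.univ := by linarith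
    rw [h3, abs_of_nonneg (by positivity), ENNReal.ofReal_add (by positivity) (by positivity)]
    simp
  rw [htot]
  exact le_iSup₂_of_le s hs (le_iSup_of_le hs1 le_rfl)

end KernelLemmas

/-! ### Second-order stationary random measures -/

section UnitCube

variable (d : ℕ)

lemma unitCube_eq_preimage :
    unitCube d = (MeasurableEquiv.toLp 2 (Fin d → ℝ)).symm ⁻¹' Set.Icc 0 1 := by
  ext x
  simp [unitCube, Pi.le_def, forall_and]

lemma measurableSet_unitCube : MeasurableSet (unitCube d) := by
  rw [unitCube_eq_preimage]
  exact (MeasurableEquiv.toLp 2 (Fin d → ℝ)).symm.measurable measurableSet_Icc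

lemma volume_unitCube : volume (unitCube d) = 1 := by
  rw [unitCube_eq_preimage,
    (EuclideanSpace.volume_preserving_symm_measurableEquiv_toLp (Fin d)).measure_preimage
      measurableSet_Icc.nullMeasurableSet, Real.volume_Icc_pi]
  simp

lemma isBounded_unitCube : Bornology.IsBounded (unitCube d) := by
  refine (Metric.isBounded_closedBall (x := (0 : Rd d)) (r := Real.sqrt d)).subset fun x hx => ?_
  rw [mem_closedBall_zero_iff, EuclideanSpace.norm_eq]
  refine Real.sqrt_le_sqrt ?_
  calc ∑ i, ‖x i‖ ^ 2 ≤ ∑ _i : Fin d, (1 : ℝ) := by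
        refine Finset.sum_le_sum fun i _ => ?_
        have := hx i
        rw [Real.norm_eq_abs, sq_abs]
        exact pow_le_one₀ this.1 this.2
    _ = d := by simp

end UnitCube

/-- Jensen's inequality for the square. -/
lemma sq_lintegral_le_lintegral_sq {X : Type*} [MeasurableSpace X] (μ : Measure X)
    [IsProbabilityMeasure μ] {f : X → ℝ≥0∞} (hf : Measurable f) :
    (∫⁻ x, f x ∂μ) ^ 2 ≤ ∫⁻ x, f x ^ 2 ∂μ := by
  have h := ENNReal.lintegral_mul_le_Lp_mul_Lq μ (p := 2) (q := 2) Real.HolderConjugate.two_two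
    hf.aemeasurable (aemeasurable_const (b := (1 : ℝ≥0∞)))
  simp only [Pi.mul_apply, mul_one, ENNReal.one_rpow, lintegral_const, measure_univ] at h
  calc (∫⁻ x, f x ∂μ) ^ 2 ≤ ((∫⁻ x, f x ^ (2 : ℝ) ∂μ) ^ (1 / 2 : ℝ)) ^ 2 := by gcongr
    _ = ∫⁻ x, f x ^ 2 ∂μ := by
      rw [← ENNReal.rpow_natCast, ← ENNReal.rpow_mul]
      norm_num

section SecondOrder

variable {d : ℕ} {Ω : Type*} [MeasurableSpace Ω] {P : Measure Ω}

lemma lintegral_reducedSecondMoment (Ψ : Kernel Ω (Rd d)) [IsSFiniteKernel Ψ]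
    {h : Rd d → ℝ≥0∞} (hh : Measurable h) :
    ∫⁻ y, h y ∂(reducedSecondMoment P Ψ) =
      ∫⁻ ω, ∫⁻ x in unitCube d, ∫⁻ y, h (y - x) ∂(Ψ ω) ∂(Ψ ω) ∂P := by
  have hS : MeasurableSet (unitCube d ×ˢ (Set.univ : Set (Rd d))) :=
    (measurableSet_unitCube d).prod MeasurableSet.univ
  have hsub : Measurable fun p : Rd d × Rd d => p.2 - p.1 := measurable_snd.sub measurable_fst
  have hm : Measurable fun ω =>
      (((Ψ ω).prod (Ψ ω)).restrict (unitCube d ×ˢ Set.univ)).map (fun p => p.2 - p.1) := by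
    have := (((Ψ ×ₖ Ψ).restrict hS).map fun p => p.2 - p.1).measurable
    convert! this using 2 with ω
    rw [Kernel.map_apply _ hsub, Kernel.restrict_apply, Kernel.prod_apply]
  rw [reducedSecondMoment, Measure.lintegral_bind hm.aemeasurable hh.aemeasurable]
  congr 1 with ω
  rw [lintegral_map hh hsub, ← Measure.prod_restrict, Measure.restrict_univ,
    lintegral_prod (fun p : Rd d × Rd d => h (p.2 - p.1)) (hh.comp hsub).aemeasurable]

/-- Local square-integrability makes the reduced second moment measure locally finite. -/
lemma IsLocallySquareIntegrable.reducedSecondMoment_lt_top {Ψ : Kernel Ω (Rd d)}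
    [IsSFiniteKernel Ψ] (hΨ : IsLocallySquareIntegrable P Ψ) {B : Set (Rd d)}
    (hB : MeasurableSet B) (hb : Bornology.IsBounded B) : reducedSecondMoment P Ψ B < ∞ := by
  obtain ⟨R, hR⟩ := hb.subset_closedBall 0
  obtain ⟨T, hT⟩ := (isBounded_unitCube d).subset_closedBall 0
  set D := Metric.closedBall (0 : Rd d) (max T (R + T)) with hD
  refine lt_of_le_of_lt ?_
    (hΨ D Metric.isClosed_closedBall.measurableSet Metric.isBounded_closedBall)
  rw [← lintegral_indicator_one hB, lintegral_reducedSecondMoment Ψ (measurable_one.indicator hB)]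
  refine lintegral_mono fun ω => ?_
  calc ∫⁻ x in unitCube d, ∫⁻ y, B.indicator 1 (y - x) ∂(Ψ ω) ∂(Ψ ω)
      ≤ ∫⁻ _x in unitCube d, Ψ ω D ∂(Ψ ω) := by
        refine setLIntegral_mono measurable_const fun x hx => ?_
        rw [← lintegral_indicator_one (μ := Ψ ω)
          (Metric.isClosed_closedBall (x := (0 : Rd d)) (ε := max T (R + T))).measurableSet]
        refine lintegral_mono fun y => ?_
        by_cases hy : y - x ∈ B
        · have h1 : ‖y - x‖ ≤ R := by simpa using hR hy
          have h2 : ‖x‖ ≤ T := by simpa using hT hx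
          have h3 : ‖y‖ ≤ ‖y - x‖ + ‖x‖ := by simpa using norm_add_le (y - x) x
          have hyD : y ∈ Metric.closedBall (0 : Rd d) (max T (R + T)) := by
            rw [mem_closedBall_zero_iff]
            exact (h3.trans (add_le_add h1 h2)).trans (le_max_right _ _)
          rw [Set.indicator_of_mem hyD]
          exact Set.indicator_le_self' (fun _ _ => zero_le) _
        · simp [hy]
    _ = Ψ ω D * Ψ ω (unitCube d) := by rw [setLIntegral_const]
    _ ≤ Ψ ω D ^ 2 := by
      rw [sq]
      gcongr
      exact hT.trans (Metric.closedBall_subset_closedBall (le_max_left _ _))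

lemma isLocallyFiniteMeasure_of_bounded {μ : Measure (Rd d)}
    (h : ∀ B, MeasurableSet B → Bornology.IsBounded B → μ B < ∞) : IsLocallyFiniteMeasure μ :=
  ⟨fun x => ⟨Metric.ball x 1, Metric.ball_mem_nhds x one_pos,
    h _ measurableSet_ball Metric.isBounded_ball⟩⟩

/-- Second-order stationarity of a random measure `Ψ`: its first moment measure is `γ` times
Lebesgue measure, and its second moment measure disintegrates along the diagonal translations,
with the reduced second moment measure as the other factor. -/
structure IsSecondOrderStationary (P : Measure Ω) (Ψ : Kernel Ω (Rd d)) (γ : ℝ≥0∞) : Prop where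
  mean : ∀ f : Rd d → ℝ≥0∞, Measurable f → ∫⁻ ω, ∫⁻ x, f x ∂(Ψ ω) ∂P = γ * ∫⁻ x, f x
  second : ∀ F : Rd d × Rd d → ℝ≥0∞, Measurable F →
    ∫⁻ ω, ∫⁻ x, ∫⁻ y, F (x, y) ∂(Ψ ω) ∂(Ψ ω) ∂P =
      ∫⁻ x, ∫⁻ y, F (x, x + y) ∂(reducedSecondMoment P Ψ)

namespace IsSecondOrderStationary

variable {Ψ : Kernel Ω (Rd d)} {γ : ℝ≥0∞}

lemma intensity_eq (h : IsSecondOrderStationary P Ψ γ) : intensity P Ψ = γ := by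
  have := h.mean _ (measurable_one.indicator (measurableSet_unitCube d))
  simp_rw [lintegral_indicator_one (measurableSet_unitCube d)] at this
  rw [intensity, this, volume_unitCube, mul_one]

/-- Conversely to `IsLocallySquareIntegrable.reducedSecondMoment_lt_top`, local finiteness of the
reduced second moment measure gives local square-integrability. -/
lemma isLocallySquareIntegrable (h : IsSecondOrderStationary P Ψ γ)
    (hα : ∀ B, MeasurableSet B → Bornology.IsBounded B → reducedSecondMoment P Ψ B < ∞) :
    IsLocallySquareIntegrable P Ψ := by
  intro B hB hb
  obtain ⟨R, hR⟩ := hb.subset_closedBall 0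
  set D := Metric.closedBall (0 : Rd d) (R + R) with hD
  have hDm : MeasurableSet D := Metric.isClosed_closedBall.measurableSet
  have h1 : ∫⁻ ω, Ψ ω B ^ 2 ∂P =
      ∫⁻ ω, ∫⁻ x, ∫⁻ y, (B ×ˢ B).indicator 1 (x, y) ∂(Ψ ω) ∂(Ψ ω) ∂P := by
    congr 1 with ω
    have : ∀ x y : Rd d, (B ×ˢ B).indicator (1 : Rd d × Rd d → ℝ≥0∞) (x, y) =
        B.indicator 1 x * B.indicator 1 y := fun x y => by
      by_cases hx : x ∈ B <;> by_cases hy : y ∈ B <;> simp [hx, hy]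
    simp_rw [this]
    rw [lintegral_lintegral_mul (measurable_one.indicator hB).aemeasurable
      (measurable_one.indicator hB).aemeasurable, lintegral_indicator_one hB, sq]
  rw [h1, h.second _ (measurable_one.indicator (hB.prod hB))]
  calc ∫⁻ x, ∫⁻ y, (B ×ˢ B).indicator 1 (x, x + y) ∂(reducedSecondMoment P Ψ)
      ≤ ∫⁻ x : Rd d, B.indicator (fun _ => reducedSecondMoment P Ψ D) x := by
        refine lintegral_mono fun x => ?_
        by_cases hx : x ∈ B
        · rw [Set.indicator_of_mem hx, ← lintegral_indicator_one hDm]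
          refine lintegral_mono fun y => ?_
          by_cases hy : x + y ∈ B
          · have h2 : ‖x‖ ≤ R := by simpa using hR hx
            have h3 : ‖x + y‖ ≤ R := by simpa using hR hy
            have h4 : ‖y‖ ≤ ‖x + y‖ + ‖x‖ := by simpa using norm_sub_le (x + y) x
            have hyD : y ∈ D := by
              rw [hD, mem_closedBall_zero_iff]
              linarith
            rw [Set.indicator_of_mem hyD]
            exact Set.indicator_le_self' (fun _ _ => zero_le) _
          · simp [hy]
        · simp [hx]
    _ = reducedSecondMoment P Ψ D * volume B := by rw [lintegral_indicator_const hB]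
    _ < ∞ := ENNReal.mul_lt_top (hα D hDm Metric.isBounded_closedBall) hb.measure_lt_top

/-- The reduced second moment measure is symmetric, by interchanging the two points. -/
lemma lintegral_neg [IsSFiniteKernel Ψ] [SFinite (reducedSecondMoment P Ψ)]
    (h : IsSecondOrderStationary P Ψ γ)
    {g : Rd d → ℝ≥0∞} (hg : Measurable g) :
    ∫⁻ y, g (-y) ∂(reducedSecondMoment P Ψ) = ∫⁻ y, g y ∂(reducedSecondMoment P Ψ) := by
  set c : Rd d → ℝ≥0∞ := (unitCube d).indicator 1 with hc
  have hcm : Measurable c := measurable_one.indicator (measurableSet_unitCube d)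
  have hc1 : ∫⁻ x, c x = 1 := by
    rw [hc, lintegral_indicator_one (measurableSet_unitCube d), volume_unitCube]
  have hF : Measurable fun p : Rd d × Rd d => c p.1 * g (p.2 - p.1) :=
    (hcm.comp measurable_fst).mul (hg.comp (measurable_snd.sub measurable_fst))
  have h1 := h.second _ hF
  have h2 := h.second _ (hF.comp measurable_swap)
  have h3 : ∫⁻ ω, ∫⁻ x, ∫⁻ y, c y * g (x - y) ∂(Ψ ω) ∂(Ψ ω) ∂P =
      ∫⁻ ω, ∫⁻ x, ∫⁻ y, c x * g (y - x) ∂(Ψ ω) ∂(Ψ ω) ∂P := by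
    congr 1 with ω
    exact lintegral_lintegral_swap (hF.comp measurable_swap).aemeasurable
  simp only [Function.comp_apply, Prod.swap_prod_mk, add_sub_cancel_left] at h1 h2
  rw [h3, h1] at h2
  have h4 : ∀ x y : Rd d, x - (x + y) = -y := fun x y => by abel
  simp_rw [h4] at h2
  have h5 : ∫⁻ x, ∫⁻ y, c x * g y ∂(reducedSecondMoment P Ψ) =
      ∫⁻ y, g y ∂(reducedSecondMoment P Ψ) := by
    rw [lintegral_lintegral_mul hcm.aemeasurable hg.aemeasurable, hc1, one_mul]
  have h6 : ∫⁻ x, ∫⁻ y, c (x + y) * g (-y) ∂(reducedSecondMoment P Ψ) =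
      ∫⁻ y, g (-y) ∂(reducedSecondMoment P Ψ) := by
    rw [lintegral_lintegral_swap ((hcm.comp (measurable_fst.add measurable_snd)).mul
      (hg.comp measurable_snd.neg)).aemeasurable]
    congr 1 with y
    have hcy : Measurable fun x => c (x + y) := hcm.comp (measurable_add_const y)
    rw [lintegral_mul_const _ hcy,
      lintegral_add_right_eq_self c y, hc1, one_mul]
  rw [← h6, ← h2, h5]

/-- The covariance measure is positive definite: `∫ f ⋆ f dβ_Ψ` is the variance of `∫ f dΨ`. -/
lemma covarianceIntegral_nonneg [IsProbabilityMeasure P] [IsSFiniteKernel Ψ]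
    [IsLocallyFiniteMeasure (reducedSecondMoment P Ψ)]
    (h : IsSecondOrderStationary P Ψ γ) (hγ : γ ≠ ∞)
    {f : Rd d → ℝ} (hf : IsTestFunction f) :
    0 ≤ covarianceIntegral P Ψ (tiltedConv f f) := by
  set α := reducedSecondMoment P Ψ with hα
  set X : Ω → ℝ := fun ω => ∫ x, f x ∂(Ψ ω) with hX
  have hXm : StronglyMeasurable X := hf.measurable.stronglyMeasurable.integral_kernel
  -- the first moment
  have hmean : Ψ ∘ₘ P = γ • volume := by
    ext B hB
    rw [Measure.bind_apply hB Ψ.aemeasurable]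
    simp_rw [← lintegral_indicator_one (μ := Ψ _) hB]
    rw [h.mean _ (measurable_one.indicator hB), lintegral_indicator_one hB, Measure.smul_apply,
      smul_eq_mul]
  have hEX : ∫ ω, X ω ∂P = γ.toReal * ∫ x, f x := by
    have hi : Integrable f (Ψ ∘ₘ P) := by
      rw [hmean]; exact (hf.integrable volume).smul_measure hγ
    have h1 : ∫ x, f x ∂(Ψ ∘ₘ P) = ∫ ω, X ω ∂P := by
      rw [Measure.comp_eq_comp_const_apply] at hi ⊢
      rw [Kernel.integral_comp hi, Kernel.const_apply]
    rw [← h1, hmean, integral_smul_measure, smul_eq_mul]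
  -- the second moment
  have hsec : (Ψ ×ₖ Ψ) ∘ₘ P = ((volume : Measure (Rd d)).prod α).map fun p => (p.1, p.1 + p.2) := by
    have hφ : Measurable fun p : Rd d × Rd d => (p.1, p.1 + p.2) :=
      measurable_fst.prodMk (measurable_fst.add measurable_snd)
    ext B hB
    have hBi : Measurable (B.indicator (1 : Rd d × Rd d → ℝ≥0∞)) := measurable_one.indicator hB
    rw [Measure.bind_apply hB (Ψ ×ₖ Ψ).aemeasurable, ← lintegral_indicator_one hB,
      lintegral_map hBi hφ, lintegral_prod (fun p : Rd d × Rd d => B.indicator 1 (p.1, p.1 + p.2))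
        (hBi.comp hφ).aemeasurable, ← h.second _ hBi]
    congr 1 with ω
    rw [Kernel.prod_apply, ← lintegral_indicator_one hB, lintegral_prod _ hBi.aemeasurable]
  have hφ : Measurable fun p : Rd d × Rd d => (p.1, p.1 + p.2) :=
    measurable_fst.prodMk (measurable_fst.add measurable_snd)
  have hffm : Measurable fun p : Rd d × Rd d => f p.1 * f p.2 :=
    (hf.measurable.comp measurable_fst).mul (hf.measurable.comp measurable_snd)
  have hprod : Integrable (fun p : Rd d × Rd d => f p.1 * f (p.1 + p.2))
      ((volume : Measure (Rd d)).prod α) := by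
    obtain ⟨C, R, hC0, hC, hR⟩ := hf.exists_bound
    have hbig : Integrable ((Metric.closedBall (0 : Rd d) R ×ˢ
        Metric.closedBall (0 : Rd d) (R + R)).indicator fun _ => C * C)
        ((volume : Measure (Rd d)).prod α) := by
      rw [integrable_indicator_iff
        (Metric.isClosed_closedBall.measurableSet.prod Metric.isClosed_closedBall.measurableSet)]
      refine integrableOn_const ?_
      rw [Measure.prod_prod]
      exact ENNReal.mul_ne_top (isCompact_closedBall _ _).measure_lt_top.ne
        (isCompact_closedBall _ _).measure_lt_top.ne
    refine hbig.mono (hffm.comp hφ).aestronglyMeasurable (ae_of_all _ fun p => ?_)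
    by_cases h0 : f p.1 * f (p.1 + p.2) = 0
    · simp [h0]
    · have h1 := hR _ (left_ne_zero_of_mul h0)
      have h2 := hR _ (right_ne_zero_of_mul h0)
      have h3 : ‖p.2‖ ≤ ‖p.1 + p.2‖ + ‖p.1‖ := by simpa using norm_sub_le (p.1 + p.2) p.1
      have hmem : p ∈ Metric.closedBall (0 : Rd d) R ×ˢ Metric.closedBall (0 : Rd d) (R + R) :=
        ⟨by simpa using h1, by simpa using h3.trans (add_le_add h2 h1)⟩
      rw [Set.indicator_of_mem hmem, norm_mul, Real.norm_eq_abs, Real.norm_eq_abs,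
        Real.norm_eq_abs, abs_of_nonneg (mul_nonneg hC0 hC0)]
      exact mul_le_mul (hC _) (hC _) (abs_nonneg _) hC0
  have hi2 : Integrable (fun p : Rd d × Rd d => f p.1 * f p.2) ((Ψ ×ₖ Ψ) ∘ₘ P) := by
    rw [hsec, integrable_map_measure hffm.aestronglyMeasurable hφ.aemeasurable]
    exact hprod
  have hXX : ∀ ω, ∫ p, f p.1 * f p.2 ∂((Ψ ×ₖ Ψ) ω) = X ω ^ 2 := fun ω => by
    rw [Kernel.prod_apply, integral_prod_mul, sq]
  have hX2 : Integrable (fun ω => X ω ^ 2) P := by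
    have h1 := hi2
    rw [Measure.comp_eq_comp_const_apply] at h1
    have h2 := h1.integral_comp
    rw [Kernel.const_apply] at h2
    exact h2.congr (ae_of_all _ hXX)
  have hEX2 : ∫ ω, X ω ^ 2 ∂P = ∫ y, tiltedConv f f y ∂α := by
    have h1 : ∫ p, f p.1 * f p.2 ∂((Ψ ×ₖ Ψ) ∘ₘ P) = ∫ ω, X ω ^ 2 ∂P := by
      rw [Measure.comp_eq_comp_const_apply] at hi2 ⊢
      rw [Kernel.integral_comp hi2, Kernel.const_apply]
      simp_rw [hXX]
    rw [← h1, hsec, integral_map hφ.aemeasurable hffm.aestronglyMeasurable,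
      integral_prod_symm _ hprod]
    congr 1 with y
    rw [tiltedConv, ← integral_add_right_eq_self (fun x => f x * f (x - y)) y]
    congr 1 with x
    rw [add_sub_cancel_right, mul_comm]
  have hvar := variance_nonneg X P
  rw [variance_eq_sub ((memLp_two_iff_integrable_sq hXm.aestronglyMeasurable).2 hX2)] at hvar
  simp only [Pi.pow_apply] at hvar
  rw [hEX2, hEX] at hvar
  rw [covarianceIntegral, h.intensity_eq, hf.integral_tiltedConv hf]
  linarith

end IsSecondOrderStationary

end SecondOrder

/-! ### The Palm measure -/

section Palm

lemma image_add_right_eq_preimage {d : ℕ} (x : Rd d) (B : Set (Rd d)) :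
    (fun y => y + x) '' B = (fun y => y - x) ⁻¹' B := by
  ext y
  simp only [Set.mem_image, Set.mem_preimage]
  exact ⟨fun ⟨z, hz, h⟩ => by rw [← h, add_sub_cancel_right]; exact hz,
    fun h => ⟨y - x, h, sub_add_cancel y x⟩⟩

lemma IsInvariantMeasure.map_sub_eq {d : ℕ} {Ω : Type*} {θ : Rd d → Ω → Ω}
    {Φ : Ω → Measure (Rd d)} (h : IsInvariantMeasure θ Φ) (ω : Ω) (x : Rd d) :
    (Φ ω).map (fun y => y - x) = Φ (θ x ω) := by
  ext B hB
  rw [Measure.map_apply (measurable_sub_const x) hB, ← h ω x B hB, image_add_right_eq_preimage]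

variable {d : ℕ} {Ω : Type*} [MeasurableSpace Ω] {P : Measure Ω} {θ : Rd d → Ω → Ω}

lemma IsMeasurableFlow.measurable_comp (hθ : IsMeasurableFlow θ) {X : Type*} [MeasurableSpace X]
    {u : X → Rd d} {v : X → Ω} (hu : Measurable u) (hv : Measurable v) :
    Measurable fun x => θ (u x) (v x) :=
  hθ.measurable.comp (hv.prodMk hu)

lemma IsLocallySquareIntegrable.lintegral_lt_top [IsProbabilityMeasure P] {Φ : Kernel Ω (Rd d)}
    (h : IsLocallySquareIntegrable P Φ) {B : Set (Rd d)} (hB : MeasurableSet B)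
    (hb : Bornology.IsBounded B) : ∫⁻ ω, Φ ω B ∂P < ∞ := by
  have h1 := (sq_lintegral_le_lintegral_sq P (Φ.measurable_coe hB)).trans_lt (h B hB hb)
  by_contra h2
  rw [not_lt, top_le_iff] at h2
  simp [h2] at h1

variable [IsProbabilityMeasure P]

/-- The refined Campbell theorem: under the measure `E ∫ 1{(x, θₓ) ∈ ·} Φ(dx)` the two components
decouple. For a fixed event, this is a translation invariant measure in the first one, hence a
multiple of Lebesgue measure, and the factor is read off from the unit cube. -/
theorem lintegral_campbell_palm (hθ : IsMeasurableFlow θ) (hP : ∀ x, MeasurePreserving (θ x) P P)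
    (Φ : Kernel Ω (Rd d)) [IsSFiniteKernel Φ] (hΦinv : IsInvariantMeasure θ Φ)
    (hΦsq : IsLocallySquareIntegrable P Φ) (hΦpos : 0 < intensity P Φ)
    {F : Rd d × Ω → ℝ≥0∞} (hF : Measurable F) :
    ∫⁻ ω, ∫⁻ x, F (x, θ x ω) ∂(Φ ω) ∂P =
      intensity P Φ * ∫⁻ x, ∫⁻ ω, F (x, ω) ∂(palm P θ Φ) := by
  have hcube := measurableSet_unitCube d
  have hγ : intensity P Φ ≠ ∞ := (hΦsq.lintegral_lt_top hcube (isBounded_unitCube d)).ne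
  have hθm : Measurable (Function.uncurry fun (ω : Ω) (x : Rd d) => (x, θ x ω)) :=
    measurable_snd.prodMk (hθ.measurable_comp measurable_snd measurable_fst)
  have hθm' : Measurable (Function.uncurry fun (ω : Ω) (x : Rd d) => θ x ω) :=
    hθ.measurable_comp measurable_snd measurable_fst
  have hΛm : Measurable fun ω => (Φ ω).map fun x => (x, θ x ω) := measurable_map_kernel Φ hθm
  have hCm : Measurable fun ω => ((Φ ω).restrict (unitCube d)).map fun x => θ x ω := by
    exact measurable_map_kernel (Φ.restrict hcube) hθm'
  set Λ : Measure (Rd d × Ω) := P.bind fun ω => (Φ ω).map fun x => (x, θ x ω) with hΛ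
  set C : Measure Ω := P.bind fun ω => ((Φ ω).restrict (unitCube d)).map fun x => θ x ω with hC
  have hΛint : ∀ G : Rd d × Ω → ℝ≥0∞, Measurable G →
      ∫⁻ p, G p ∂Λ = ∫⁻ ω, ∫⁻ x, G (x, θ x ω) ∂(Φ ω) ∂P := fun G hG => by
    rw [hΛ, Measure.lintegral_bind hΛm.aemeasurable hG.aemeasurable]
    congr 1 with ω
    exact lintegral_map hG (hθm.comp measurable_prodMk_left)
  have hθx : ∀ ω, Measurable fun x => θ x ω := fun ω =>
    hθ.measurable_comp measurable_id measurable_const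
  have hθxx : ∀ ω, Measurable fun x => (x, θ x ω) := fun ω => measurable_id.prodMk (hθx ω)
  have hCB : ∀ B, MeasurableSet B → C B = Λ (unitCube d ×ˢ B) := fun B hB => by
    rw [hC, hΛ, Measure.bind_apply hB hCm.aemeasurable,
      Measure.bind_apply (hcube.prod hB) hΛm.aemeasurable]
    congr 1 with ω
    rw [Measure.map_apply (hθx ω) hB,
      Measure.map_apply (hθxx ω) (hcube.prod hB),
      Measure.restrict_apply (hθx ω hB), Set.mk_preimage_prod, Set.inter_comm]
    rfl
  have hCuniv : C Set.univ = intensity P Φ := by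
    rw [hC, Measure.bind_apply MeasurableSet.univ hCm.aemeasurable, intensity]
    congr 1 with ω
    rw [Measure.map_apply (hθx ω) MeasurableSet.univ]
    simp
  have hCfin : IsFiniteMeasure C := ⟨by rw [hCuniv]; exact hγ.lt_top⟩
  -- invariance of `Λ` under translations of the first component
  have hshift : ∀ (t : Rd d) (G : Rd d × Ω → ℝ≥0∞), Measurable G →
      ∫⁻ p, G (t + p.1, p.2) ∂Λ = ∫⁻ p, G p ∂Λ := fun t G hG => by
    have hG' : Measurable fun p : Rd d × Ω => G (t + p.1, p.2) :=
      hG.comp ((measurable_fst.const_add t).prodMk measurable_snd)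
    rw [hΛint _ hG', hΛint _ hG]
    have hm : Measurable fun ω => ∫⁻ x, G (t + x, θ x ω) ∂(Φ ω) :=
      Measurable.lintegral_kernel_prod_right (hG'.comp hθm)
    rw [← (hP t).lintegral_comp hm]
    congr 1 with ω
    have hm' : Measurable fun x => G (t + x, θ x (θ t ω)) := hG'.comp (hθxx (θ t ω))
    rw [← hΦinv.map_sub_eq ω t, lintegral_map hm' (measurable_sub_const t)]
    congr 1 with x
    rw [add_sub_cancel, hθ.add, sub_add_cancel]
  have hprod : (volume : Measure (Rd d)).prod C = Λ := by
    refine Measure.prod_eq fun A B hA hB => ?_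
    set ν : Measure (Rd d) := (Λ.restrict (Set.univ ×ˢ B)).map Prod.fst with hν
    have hνA : ∀ A, MeasurableSet A → ν A = Λ (A ×ˢ B) := fun A hA => by
      rw [hν, Measure.map_apply measurable_fst hA, Measure.restrict_apply (measurable_fst hA)]
      congr 1
      ext p
      simp
    have hνfin : IsLocallyFiniteMeasure ν := by
      refine isLocallyFiniteMeasure_of_bounded fun D hD hDb => ?_
      rw [hνA D hD, ← lintegral_indicator_one (hD.prod hB),
        hΛint _ (measurable_one.indicator (hD.prod hB))]
      refine lt_of_le_of_lt ?_ (hΦsq.lintegral_lt_top hD hDb)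
      refine lintegral_mono fun ω => ?_
      rw [← lintegral_indicator_one (μ := Φ ω) hD]
      refine lintegral_mono fun x => ?_
      by_cases hx : x ∈ D
      · rw [Set.indicator_of_mem hx]
        exact Set.indicator_le_self' (fun _ _ => zero_le) _
      · simp [hx]
    have hνinv : ν.IsAddLeftInvariant := by
      refine ⟨fun t => ?_⟩
      ext D hD
      have hD' : MeasurableSet ((fun x => t + x) ⁻¹' D) := measurable_const_add t hD
      rw [Measure.map_apply (measurable_const_add t) hD, hνA _ hD', hνA D hD,
        ← lintegral_indicator_one (hD.prod hB), ← lintegral_indicator_one (hD'.prod hB),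
        ← hshift t _ (measurable_one.indicator (hD.prod hB))]
      congr 1 with p
    have hsmul := Measure.isAddLeftInvariant_eq_smul ν (volume : Measure (Rd d))
    rw [hCB B hB, ← hνA A hA, ← hνA _ hcube, hsmul]
    simp only [Measure.smul_apply, volume_unitCube]
    rw [ENNReal.smul_def, ENNReal.smul_def, smul_eq_mul, smul_eq_mul, mul_one, mul_comm]
  rw [← hΛint F hF, ← hprod, lintegral_prod _ hF.aemeasurable]
  have hpalm : palm P θ Φ = (intensity P Φ)⁻¹ • C := rfl
  simp_rw [hpalm, lintegral_smul_measure, smul_eq_mul]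
  rw [lintegral_const_mul _ hF.lintegral_prod_right', ← mul_assoc,
    ENNReal.mul_inv_cancel hΦpos.ne' hγ, one_mul]

lemma isProbabilityMeasure_palm (hθ : IsMeasurableFlow θ)
    (Φ : Kernel Ω (Rd d)) [IsSFiniteKernel Φ]
    (hΦsq : IsLocallySquareIntegrable P Φ) (hΦpos : 0 < intensity P Φ) :
    IsProbabilityMeasure (palm P θ Φ) := by
  have hcube := measurableSet_unitCube d
  have hγ : intensity P Φ ≠ ∞ := (hΦsq.lintegral_lt_top hcube (isBounded_unitCube d)).ne
  have hCm : Measurable fun ω => ((Φ ω).restrict (unitCube d)).map fun x => θ x ω :=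
    measurable_map_kernel (Φ.restrict hcube) (hθ.measurable_comp measurable_snd measurable_fst)
  refine ⟨?_⟩
  rw [palm, Measure.smul_apply, Measure.bind_apply MeasurableSet.univ hCm.aemeasurable]
  have : ∀ ω, ((Φ ω).restrict (unitCube d)).map (fun x => θ x ω) Set.univ = Φ ω (unitCube d) :=
    fun ω => by
    have hm : Measurable fun x => θ x ω := hθ.measurable_comp measurable_id measurable_const
    rw [Measure.map_apply hm MeasurableSet.univ]
    simp
  simp_rw [this]
  exact ENNReal.inv_mul_cancel hΦpos.ne' hγ

end Palm

/-! ### Moments of the destination of an invariant transport -/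

lemma integral_bind_kernel {X Y E : Type*} [MeasurableSpace X] [MeasurableSpace Y]
    [NormedAddCommGroup E] [NormedSpace ℝ E] {μ : Measure X} {κ : Kernel X Y} {f : Y → E}
    (hf : Integrable f (μ.bind κ)) : ∫ y, f y ∂(μ.bind κ) = ∫ x, ∫ y, f y ∂(κ x) ∂μ := by
  rw [Measure.comp_eq_comp_const_apply] at hf ⊢
  rw [Kernel.integral_comp hf, Kernel.const_apply]

lemma IsInvariantKernel.relDisplacement_eq {d : ℕ} {Ω : Type*} {θ : Rd d → Ω → Ω}
    {K : Ω × Rd d → Measure (Rd d)}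
    (hK : IsInvariantKernel θ K) (ω : Ω) (x : Rd d) : relDisplacement K ω x = K (θ x ω, 0) := by
  ext B hB
  rw [relDisplacement, Measure.map_apply (measurable_sub_const x) hB, ← hK ω x B hB,
    image_add_right_eq_preimage]

lemma map_relDisplacement {d : ℕ} {Ω : Type*} (K : Ω × Rd d → Measure (Rd d)) (ω : Ω)
    (x : Rd d) :
    (relDisplacement K ω x).map (fun y => y + x) = K (ω, x) := by
  rw [relDisplacement, Measure.map_map (measurable_add_const x) (measurable_sub_const x)]
  convert! Measure.map_id
  ext y : 1
  simp

section Transport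

variable {d : ℕ} {Ω : Type*} [MeasurableSpace Ω]

/-- The destination `KΦ` as a kernel. -/
noncomputable def destinationKernel (K : Kernel (Ω × Rd d) (Rd d)) [IsSFiniteKernel K]
    (Φ : Kernel Ω (Rd d)) [IsSFiniteKernel Φ] : Kernel Ω (Rd d) where
  toFun := destination K Φ
  measurable' := by
    refine Measure.measurable_of_measurable_coe _ fun s hs => ?_
    have : ∀ ω, destination K Φ ω s = ∫⁻ x, K (ω, x) s ∂(Φ ω) := fun ω =>
      Measure.bind_apply hs (K.measurable.comp measurable_prodMk_left).aemeasurable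
    simp_rw [this]
    exact Measurable.lintegral_kernel_prod_right (K.measurable_coe hs)

/-- The relative displacement `K*` as a kernel. -/
noncomputable def relDisplacementKernel (K : Kernel (Ω × Rd d) (Rd d)) [IsSFiniteKernel K] :
    Kernel (Ω × Rd d) (Rd d) where
  toFun p := relDisplacement K p.1 p.2
  measurable' := measurable_map_kernel K (φ := fun p y => y - p.2)
    (measurable_snd.sub (measurable_snd.comp measurable_fst))

section Kernels

variable (K : Kernel (Ω × Rd d) (Rd d)) [IsMarkovKernel K]

lemma lintegral_destinationKernel (Φ : Kernel Ω (Rd d)) [IsSFiniteKernel Φ] (ω : Ω)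
    {f : Rd d → ℝ≥0∞} (hf : Measurable f) :
    ∫⁻ u, f u ∂(destinationKernel K Φ ω) = ∫⁻ x, ∫⁻ u, f u ∂(K (ω, x)) ∂(Φ ω) :=
  Measure.lintegral_bind (K.measurable.comp measurable_prodMk_left).aemeasurable hf.aemeasurable

instance (Φ : Kernel Ω (Rd d)) [IsSFiniteKernel Φ] : IsSFiniteKernel (destinationKernel K Φ) := by
  have : destinationKernel K Φ = Kernel.snd (Φ ⊗ₖ K) := by
    ext ω s hs
    rw [← lintegral_indicator_one hs,
      lintegral_destinationKernel K Φ ω (measurable_one.indicator hs),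
      Kernel.snd_apply' _ _ hs, Kernel.compProd_apply (measurable_snd hs)]
    congr 1 with x
    rw [lintegral_indicator_one hs]
    rfl
  rw [this]
  infer_instance

instance : IsMarkovKernel (relDisplacementKernel K) :=
  ⟨fun p => Measure.isProbabilityMeasure_map (measurable_sub_const p.2).aemeasurable⟩

instance (ω : Ω) (x : Rd d) : IsProbabilityMeasure (relDisplacement K ω x) :=
  Measure.isProbabilityMeasure_map (measurable_sub_const x).aemeasurable

/-- The law of the pair of relative displacements of the points `y` and `0`, given `ω`. -/
noncomputable def pairDisplacement (y : Rd d) : Kernel Ω (Rd d × Rd d) :=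
  ((relDisplacementKernel K).comap (fun ω => (ω, y)) measurable_prodMk_right) ×ₖ
    ((relDisplacementKernel K).comap (fun ω => (ω, 0)) measurable_prodMk_right)

lemma pairDisplacement_apply (y : Rd d) (ω : Ω) :
    pairDisplacement K y ω = (relDisplacement K ω y).prod (relDisplacement K ω 0) := by
  rw [pairDisplacement, Kernel.prod_apply]; rfl

instance (y : Rd d) : IsMarkovKernel (pairDisplacement K y) := by
  unfold pairDisplacement; infer_instance

/-- The kernel `y ↦ E_{0,y}[K*_y ⊗ K*_0]`. -/
noncomputable def twoPointDisplacement (Q : Kernel (Rd d) Ω) [IsSFiniteKernel Q] :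
    Kernel (Rd d) (Rd d × Rd d) where
  toFun y := (Q y).bind fun ω => (relDisplacement K ω y).prod (relDisplacement K ω 0)
  measurable' := by
    let κ : Kernel (Rd d × Ω) (Rd d × Rd d) :=
      ((relDisplacementKernel K).comap (fun p : Rd d × Ω => (p.2, p.1))
        (measurable_snd.prodMk measurable_fst)) ×ₖ
      ((relDisplacementKernel K).comap (fun p : Rd d × Ω => (p.2, 0))
        (measurable_snd.prodMk measurable_const))
    refine Measure.measurable_of_measurable_coe _ fun s hs => ?_
    have h : ∀ y, ((Q y).bind fun ω => (relDisplacement K ω y).prod (relDisplacement K ω 0)) s =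
        ∫⁻ ω, κ (y, ω) s ∂(Q y) := fun y => by
      simp_rw [← pairDisplacement_apply]
      rw [Measure.bind_apply hs (pairDisplacement K y).aemeasurable]
      congr 1 with ω
      rw [pairDisplacement_apply, Kernel.prod_apply]
      rfl
    simp_rw [h]
    exact Measurable.lintegral_kernel_prod_right (κ.measurable_coe hs)

lemma twoPointDisplacement_apply (Q : Kernel (Rd d) Ω) [IsSFiniteKernel Q] (y : Rd d) :
    twoPointDisplacement K Q y =
      (Q y).bind fun ω => (relDisplacement K ω y).prod (relDisplacement K ω 0) := rfl

lemma twoPointDisplacement_eq_bind (Q : Kernel (Rd d) Ω) [IsSFiniteKernel Q] (y : Rd d) :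
    twoPointDisplacement K Q y = (Q y).bind (pairDisplacement K y) := by
  rw [twoPointDisplacement_apply]
  congr 1 with ω : 1
  rw [pairDisplacement_apply]

instance (Q : Kernel (Rd d) Ω) [IsMarkovKernel Q] : IsMarkovKernel (twoPointDisplacement K Q) := by
  refine ⟨fun y => ⟨?_⟩⟩
  rw [twoPointDisplacement_eq_bind,
    Measure.bind_apply MeasurableSet.univ (pairDisplacement K y).aemeasurable]
  simp

lemma lintegral_twoPointDisplacement (Q : Kernel (Rd d) Ω) [IsSFiniteKernel Q] (y : Rd d)
    {H : Rd d × Rd d → ℝ≥0∞} (hH : Measurable H) :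
    ∫⁻ p, H p ∂(twoPointDisplacement K Q y) =
      ∫⁻ ω, ∫⁻ b, ∫⁻ a, H (a, b) ∂(relDisplacement K ω y) ∂(relDisplacement K ω 0) ∂(Q y) := by
  rw [twoPointDisplacement_eq_bind,
    Measure.lintegral_bind (pairDisplacement K y).aemeasurable hH.aemeasurable]
  congr 1 with ω
  rw [pairDisplacement_apply, lintegral_prod_symm _ hH.aemeasurable]

end Kernels

variable {P : Measure Ω} {θ : Rd d → Ω → Ω}

/-- Covariance of an invariant kernel under the flow. -/
lemma IsInvariantKernel.apply_flow (hθ : IsMeasurableFlow θ) {K : Ω × Rd d → Measure (Rd d)}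
    (hK : IsInvariantKernel θ K) (ω : Ω) (x y : Rd d) :
    K (θ (-x) ω, x + y) = (relDisplacement K ω y).map (fun a => a + (x + y)) := by
  rw [← map_relDisplacement K, hK.relDisplacement_eq, hK.relDisplacement_eq, hθ.add]
  congr 4
  abel

variable (K : Kernel (Ω × Rd d) (Rd d)) [IsMarkovKernel K]
  (Φ : Kernel Ω (Rd d)) [IsSFiniteKernel Φ]

/-- The first moment measure of the destination. -/
theorem lintegral_destination_first [IsProbabilityMeasure P] (hθ : IsMeasurableFlow θ)
    (hP : ∀ x, MeasurePreserving (θ x) P P) (hΦinv : IsInvariantMeasure θ Φ)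
    (hΦsq : IsLocallySquareIntegrable P Φ) (hΦpos : 0 < intensity P Φ)
    (hK : IsInvariantKernel θ K) {f : Rd d → ℝ≥0∞} (hf : Measurable f) :
    ∫⁻ ω, ∫⁻ u, f u ∂(destinationKernel K Φ ω) ∂P = intensity P Φ * ∫⁻ x, f x := by
  have := isProbabilityMeasure_palm hθ Φ hΦsq hΦpos
  have hfa : Measurable fun p : Rd d × Rd d => f (p.2 + p.1) :=
    hf.comp (measurable_snd.add measurable_fst)
  have hF : Measurable fun p : Rd d × Ω => ∫⁻ a, f (a + p.1) ∂(K (p.2, 0)) :=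
    measurable_lintegral_kernel_comp K (measurable_snd.prodMk measurable_const)
      (f := fun (p : Rd d × Ω) (a : Rd d) => f (a + p.1))
      (hf.comp (measurable_snd.add (measurable_fst.comp measurable_fst)))
  have h1 : ∀ ω, ∫⁻ u, f u ∂(destinationKernel K Φ ω) =
      ∫⁻ x, ∫⁻ a, f (a + x) ∂(K (θ x ω, 0)) ∂(Φ ω) := fun ω => by
    rw [lintegral_destinationKernel K Φ ω hf]
    congr 1 with x
    rw [← map_relDisplacement K, lintegral_map hf (measurable_add_const x), hK.relDisplacement_eq]
  simp_rw [h1]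
  rw [lintegral_campbell_palm hθ hP Φ hΦinv hΦsq hΦpos hF]
  congr 1
  rw [lintegral_lintegral_swap hF.aemeasurable]
  have h2 : ∀ ω, ∫⁻ x, ∫⁻ a, f (a + x) ∂(K (ω, 0)) = ∫⁻ x, f x := fun ω => by
    rw [lintegral_lintegral_swap hfa.aemeasurable]
    simp_rw [lintegral_add_left_eq_self]
    simp
  simp_rw [h2]
  simp

variable {Q : Kernel (Rd d) Ω}

/-- The second moment measure of the destination, seen from the pair of source points. -/
theorem lintegral_destination_second [IsMarkovKernel Q] (hθ : IsMeasurableFlow θ)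
    (hK : IsInvariantKernel θ K) (hQ : IsTwoPointPalm P θ Φ Q)
    {F : Rd d × Rd d → ℝ≥0∞} (hF : Measurable F) :
    ∫⁻ ω, ∫⁻ u, ∫⁻ v, F (u, v) ∂(destinationKernel K Φ ω) ∂(destinationKernel K Φ ω) ∂P =
      ∫⁻ x, ∫⁻ y, ∫⁻ p, F (x + p.2, x + y + p.1) ∂(twoPointDisplacement K Q y)
        ∂(reducedSecondMoment P Φ) := by
  have hG : Measurable fun q : Rd d × Rd d × Ω =>
      ∫⁻ u, ∫⁻ v, F (u, v) ∂(K (q.2.2, q.2.1)) ∂(K (q.2.2, q.1)) := by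
    refine measurable_lintegral_kernel_comp K
      ((measurable_snd.comp measurable_snd).prodMk measurable_fst)
      (f := fun (q : Rd d × Rd d × Ω) u => ∫⁻ v, F (u, v) ∂(K (q.2.2, q.2.1))) ?_
    refine measurable_lintegral_kernel_comp K
      (g := fun r : (Rd d × Rd d × Ω) × Rd d => (r.1.2.2, r.1.2.1)) (by fun_prop)
      (f := fun r v => F (r.2, v)) ?_
    exact hF.comp (by fun_prop : Measurable fun s : ((Rd d × Rd d × Ω) × Rd d) × Rd d =>
      (s.1.2, s.2))
  have h1 : ∀ ω, ∫⁻ u, ∫⁻ v, F (u, v) ∂(destinationKernel K Φ ω) ∂(destinationKernel K Φ ω) =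
      ∫⁻ x, ∫⁻ y, ∫⁻ u, ∫⁻ v, F (u, v) ∂(K (ω, y)) ∂(K (ω, x)) ∂(Φ ω) ∂(Φ ω) := fun ω => by
    have h2 : ∀ u, ∫⁻ v, F (u, v) ∂(destinationKernel K Φ ω) =
        ∫⁻ y, ∫⁻ v, F (u, v) ∂(K (ω, y)) ∂(Φ ω) := fun u =>
      lintegral_destinationKernel K Φ ω (hF.comp measurable_prodMk_left)
    rw [lintegral_destinationKernel K Φ ω hF.lintegral_prod_right']
    congr 1 with x
    simp_rw [h2]
    refine lintegral_lintegral_swap (Measurable.aemeasurable ?_)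
    exact measurable_lintegral_kernel_comp K
      (g := fun r : Rd d × Rd d => (ω, r.2)) (by fun_prop) (f := fun r v => F (r.1, v))
      (hF.comp (by fun_prop : Measurable fun s : (Rd d × Rd d) × Rd d => (s.1.1, s.2)))
  simp_rw [h1]
  rw [hQ.2 _ hG]
  congr 1 with x
  congr 1 with y
  have hH : Measurable fun p : Rd d × Rd d => F (x + p.2, x + y + p.1) :=
    hF.comp (by fun_prop)
  rw [lintegral_twoPointDisplacement K Q y hH]
  congr 1 with ω
  have hx : K (θ (-x) ω, x) = (relDisplacement K ω 0).map (fun a => a + x) := by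
    simpa using hK.apply_flow hθ ω x 0
  rw [hx, hK.apply_flow hθ, lintegral_map ?_ (measurable_add_const x)]
  · congr 1 with b
    have hFb : Measurable fun v => F (b + x, v) := hF.comp measurable_prodMk_left
    rw [lintegral_map hFb (measurable_add_const _)]
    simp_rw [add_comm]
  · exact hF.lintegral_prod_right'

/-- A translation by a quantity depending on the other variable is absorbed into Lebesgue
measure. -/
lemma lintegral_shift {X : Type*} [MeasurableSpace X] (ρ : Measure X) [SFinite ρ] {s : X → Rd d}
    (hs : Measurable s) {G : Rd d × X → ℝ≥0∞} (hG : Measurable G) :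
    ∫⁻ x, ∫⁻ r, G (x + s r, r) ∂ρ = ∫⁻ x, ∫⁻ r, G (x, r) ∂ρ := by
  have hm : Measurable fun p : Rd d × X => G (p.1 + s p.2, p.2) :=
    hG.comp ((measurable_fst.add (hs.comp measurable_snd)).prodMk measurable_snd)
  rw [lintegral_lintegral_swap hm.aemeasurable,
    lintegral_lintegral_swap (f := fun x r => G (x, r)) hG.aemeasurable]
  congr 1 with r
  exact lintegral_add_right_eq_self (fun x => G (x, r)) (s r)

/-- The displaced difference `y + a - b` of two points with difference `y`, displaced by `a`
and `b`. -/
def displace (r : Rd d × Rd d × Rd d) : Rd d := r.1 + r.2.1 - r.2.2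

lemma measurable_displace : Measurable (displace (d := d)) := by
  unfold displace; fun_prop

/-- The reduced second moment measure of the destination arises from that of the source by
displacing the two points according to `E_{0,y}[K*_y ⊗ K*_0]`. -/
theorem reducedSecondMoment_destination [IsMarkovKernel Q] [SFinite (reducedSecondMoment P Φ)]
    (hθ : IsMeasurableFlow θ) (hK : IsInvariantKernel θ K) (hQ : IsTwoPointPalm P θ Φ Q) :
    reducedSecondMoment P (destinationKernel K Φ) =
      (reducedSecondMoment P Φ ⊗ₘ twoPointDisplacement K Q).map displace := by
  ext B hB
  have hBi : Measurable (B.indicator (1 : Rd d → ℝ≥0∞)) := measurable_one.indicator hB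
  have hcube := measurableSet_unitCube d
  set c : Rd d → ℝ≥0∞ := (unitCube d).indicator 1 with hc
  have hcm : Measurable c := measurable_one.indicator hcube
  have hF : Measurable fun p : Rd d × Rd d => c p.1 * B.indicator 1 (p.2 - p.1) :=
    (hcm.comp measurable_fst).mul (hBi.comp (measurable_snd.sub measurable_fst))
  have h1 : ∀ ω, ∫⁻ x in unitCube d, ∫⁻ y, B.indicator 1 (y - x) ∂(destinationKernel K Φ ω)
      ∂(destinationKernel K Φ ω) = ∫⁻ x, ∫⁻ y, c x * B.indicator 1 (y - x)
      ∂(destinationKernel K Φ ω) ∂(destinationKernel K Φ ω) := fun ω => by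
    rw [← lintegral_indicator hcube]
    congr 1 with x
    by_cases hx : x ∈ unitCube d <;> simp [hc, hx]
  rw [← lintegral_indicator_one hB, ← lintegral_indicator_one hB,
    lintegral_reducedSecondMoment _ hBi, lintegral_map hBi measurable_displace]
  simp_rw [h1]
  rw [lintegral_destination_second K Φ hθ hK hQ hF]
  have hG : Measurable fun q : Rd d × Rd d × Rd d × Rd d =>
      c q.1 * B.indicator 1 (displace q.2) :=
    (hcm.comp measurable_fst).mul (hBi.comp (measurable_displace.comp measurable_snd))
  have h2 : ∀ x, ∫⁻ y, ∫⁻ p, c (x + p.2) * B.indicator 1 (x + y + p.1 - (x + p.2))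
      ∂(twoPointDisplacement K Q y) ∂(reducedSecondMoment P Φ) =
      ∫⁻ r, c (x + r.2.2) * B.indicator 1 (displace r)
        ∂(reducedSecondMoment P Φ ⊗ₘ twoPointDisplacement K Q) := fun x => by
    rw [Measure.lintegral_compProd]
    · congr 1 with y
      congr 1 with p
      have : x + y + p.1 - (x + p.2) = displace (y, p) := by rw [displace]; abel
      rw [this]
    · exact (hcm.comp (by fun_prop)).mul (hBi.comp measurable_displace)
  simp_rw [h2]
  rw [lintegral_shift (reducedSecondMoment P Φ ⊗ₘ twoPointDisplacement K Q)
    (s := fun r => r.2.2) (by fun_prop) hG,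
    lintegral_lintegral_mul (g := fun r => B.indicator 1 (displace r)) hcm.aemeasurable
      (hBi.comp measurable_displace).aemeasurable, hc,
    lintegral_indicator_one hcube, volume_unitCube, one_mul]

/-- The destination of an invariant transport is second-order stationary, with the intensity of
the source. -/
theorem isSecondOrderStationary_destination [IsProbabilityMeasure P] [IsMarkovKernel Q]
    [SFinite (reducedSecondMoment P Φ)] (hθ : IsMeasurableFlow θ)
    (hP : ∀ x, MeasurePreserving (θ x) P P) (hΦinv : IsInvariantMeasure θ Φ)
    (hΦsq : IsLocallySquareIntegrable P Φ) (hΦpos : 0 < intensity P Φ)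
    (hK : IsInvariantKernel θ K) (hQ : IsTwoPointPalm P θ Φ Q) :
    IsSecondOrderStationary P (destinationKernel K Φ) (intensity P Φ) where
  mean f hf := lintegral_destination_first K Φ hθ hP hΦinv hΦsq hΦpos hK hf
  second F hF := by
    rw [lintegral_destination_second K Φ hθ hK hQ hF,
      reducedSecondMoment_destination K Φ hθ hK hQ]
    have hF' : ∀ x, Measurable fun y => F (x, x + y) := fun x =>
      hF.comp (measurable_const.prodMk (measurable_const_add x))
    simp_rw [fun x => lintegral_map
      (μ := reducedSecondMoment P Φ ⊗ₘ twoPointDisplacement K Q) (hF' x) measurable_displace]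
    have hG : Measurable fun q : Rd d × Rd d × Rd d × Rd d => F (q.1, q.1 + displace q.2) :=
      hF.comp (measurable_fst.prodMk
        (measurable_fst.add (measurable_displace.comp measurable_snd)))
    rw [← lintegral_shift (reducedSecondMoment P Φ ⊗ₘ twoPointDisplacement K Q)
      (s := fun r => r.2.2) (by fun_prop) hG]
    congr 1 with x
    rw [Measure.lintegral_compProd]
    · congr 1 with y
      congr 1 with p
      have : x + p.2 + displace (y, p) = x + y + p.1 := by rw [displace]; abel
      rw [this]
    · exact hF.comp (((by fun_prop : Measurable fun r : Rd d × Rd d × Rd d => x + r.2.2)).prodMk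
        ((by fun_prop : Measurable fun r : Rd d × Rd d × Rd d => x + r.2.2).add
          measurable_displace))

end Transport

/-! ### Non-random transports -/

section Translate

variable {d : ℕ} {Ω : Type*} [MeasurableSpace Ω]

/-- The non-random kernel `(ω, x) ↦ L₀(· - x)`. -/
noncomputable def translateKernel (Ω : Type*) [MeasurableSpace Ω] (L₀ : Measure (Rd d))
    [SFinite L₀] : Kernel (Ω × Rd d) (Rd d) where
  toFun p := L₀.map fun z => z + p.2
  measurable' := measurable_map_kernel (Kernel.const (Ω × Rd d) L₀) (φ := fun p z => z + p.2)
    (measurable_snd.add (measurable_snd.comp measurable_fst))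

variable (L₀ : Measure (Rd d)) [IsProbabilityMeasure L₀]

lemma translateKernel_apply (p : Ω × Rd d) :
    translateKernel Ω L₀ p = L₀.map fun z => z + p.2 := rfl

instance : IsMarkovKernel (translateKernel Ω L₀) :=
  ⟨fun p => Measure.isProbabilityMeasure_map (measurable_add_const p.2).aemeasurable⟩

lemma relDisplacement_translateKernel (ω : Ω) (x : Rd d) :
    relDisplacement (translateKernel Ω L₀) ω x = L₀ := by
  rw [relDisplacement, translateKernel_apply,
    Measure.map_map (measurable_sub_const x) (measurable_add_const x)]
  convert! Measure.map_id
  ext y : 1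
  simp

lemma isInvariantKernel_translateKernel (θ : Rd d → Ω → Ω) :
    IsInvariantKernel θ (translateKernel Ω L₀) := by
  intro ω x B hB
  have h := congrArg (fun μ : Measure (Rd d) => μ B) (relDisplacement_translateKernel L₀ ω x)
  simp only [relDisplacement] at h
  rw [Measure.map_apply (measurable_sub_const x) hB] at h
  rw [image_add_right_eq_preimage, h, translateKernel_apply]
  simp

lemma twoPointDisplacement_translateKernel (Q : Kernel (Rd d) Ω) [IsMarkovKernel Q] (y : Rd d) :
    twoPointDisplacement (translateKernel Ω L₀) Q y = L₀.prod L₀ := by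
  rw [twoPointDisplacement_apply]
  simp_rw [relDisplacement_translateKernel]
  rw [Measure.bind_const, measure_univ, one_smul]

variable {P : Measure Ω} [IsProbabilityMeasure P] {θ : Rd d → Ω → Ω}

/-- Averaging over a non-random displacement preserves local square-integrability, by Jensen's
inequality and stationarity. -/
lemma isLocallySquareIntegrable_translate (hθ : IsMeasurableFlow θ)
    (hP : ∀ x, MeasurePreserving (θ x) P P) (Φ : Kernel Ω (Rd d)) [IsSFiniteKernel Φ]
    (hΦinv : IsInvariantMeasure θ Φ) (hΦsq : IsLocallySquareIntegrable P Φ) :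
    IsLocallySquareIntegrable P (destinationKernel (translateKernel Ω L₀) Φ) := by
  intro B hB hb
  have hBi : Measurable (B.indicator (1 : Rd d → ℝ≥0∞)) := measurable_one.indicator hB
  have hΦm : Measurable fun p : Rd d × Ω => Φ (θ (-p.1) p.2) B :=
    (Φ.measurable_coe hB).comp (hθ.measurable_comp measurable_fst.neg measurable_snd)
  have h1 : ∀ ω, destinationKernel (translateKernel Ω L₀) Φ ω B =
      ∫⁻ a, Φ (θ (-a) ω) B ∂L₀ := fun ω => by
    have hm : Measurable fun p : Rd d × Rd d => B.indicator (1 : Rd d → ℝ≥0∞) (p.2 + p.1) :=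
      hBi.comp (measurable_snd.add measurable_fst)
    have hx : ∀ x, ∫⁻ u, B.indicator 1 u ∂(translateKernel Ω L₀ (ω, x)) =
        ∫⁻ a, B.indicator 1 (a + x) ∂L₀ := fun x => by
      rw [translateKernel_apply, lintegral_map hBi (measurable_add_const x)]
    rw [← lintegral_indicator_one hB, lintegral_destinationKernel _ _ _ hBi]
    simp_rw [hx]
    rw [lintegral_lintegral_swap hm.aemeasurable]
    congr 1 with a
    rw [← hΦinv.map_sub_eq ω (-a), ← lintegral_indicator_one hB,
      lintegral_map hBi (measurable_sub_const _)]
    congr 1 with x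
    rw [sub_neg_eq_add, add_comm]
  calc ∫⁻ ω, destinationKernel (translateKernel Ω L₀) Φ ω B ^ 2 ∂P
      = ∫⁻ ω, (∫⁻ a, Φ (θ (-a) ω) B ∂L₀) ^ 2 ∂P := by simp_rw [h1]
    _ ≤ ∫⁻ ω, ∫⁻ a, Φ (θ (-a) ω) B ^ 2 ∂L₀ ∂P :=
      lintegral_mono fun ω => sq_lintegral_le_lintegral_sq L₀ (hΦm.comp measurable_prodMk_right)
    _ = ∫⁻ a, ∫⁻ ω, Φ (θ (-a) ω) B ^ 2 ∂P ∂L₀ :=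
      lintegral_lintegral_swap ((hΦm.comp measurable_swap).pow_const 2).aemeasurable
    _ = ∫⁻ _a, ∫⁻ ω, Φ ω B ^ 2 ∂P ∂L₀ := by
      congr 1 with a
      exact (hP (-a)).lintegral_comp ((Φ.measurable_coe hB).pow_const 2)
    _ < ∞ := by simpa using hΦsq B hB hb

/-- A non-random displacement multiplies the spectral measure by `|L̂₀|²`. -/
theorem covarianceIntegral_translate (hθ : IsMeasurableFlow θ)
    (hP : ∀ x, MeasurePreserving (θ x) P P) (Φ : Kernel Ω (Rd d)) [IsSFiniteKernel Φ]
    (hΦinv : IsInvariantMeasure θ Φ) (hΦsq : IsLocallySquareIntegrable P Φ)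
    (hΦpos : 0 < intensity P Φ) {Q : Kernel (Rd d) Ω} (hQ : IsTwoPointPalm P θ Φ Q)
    {SΦ : Measure (Rd d)} (hSΦ : IsBartlettSpectralMeasure P Φ SΦ)
    {f g : Rd d → ℝ} (hf : IsTestFunction f) (hg : IsTestFunction g) :
    ((covarianceIntegral P (destinationKernel (translateKernel Ω L₀) Φ) (tiltedConv f g) : ℝ) : ℂ) =
      (((2 * Real.pi) ^ d : ℝ) : ℂ)⁻¹ *
        ∫ k, ((‖fourierMeas L₀ k‖ ^ 2 : ℝ) : ℂ) * (fourierFun f k * conj (fourierFun g k)) ∂SΦ := by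
  have hQm : IsMarkovKernel Q := hQ.1
  have hSloc := hSΦ.locallyFinite
  set α := reducedSecondMoment P Φ with hα
  have hαloc : IsLocallyFiniteMeasure α :=
    isLocallyFiniteMeasure_of_bounded fun B hB hb => hΦsq.reducedSecondMoment_lt_top hB hb
  have hinv := isInvariantKernel_translateKernel L₀ θ
  have hstat := isSecondOrderStationary_destination (translateKernel Ω L₀) Φ hθ hP hΦinv hΦsq
    hΦpos hinv hQ
  set αL := reducedSecondMoment P (destinationKernel (translateKernel Ω L₀) Φ) with hαL
  have hLloc : IsLocallyFiniteMeasure αL :=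
    isLocallyFiniteMeasure_of_bounded fun B hB hb =>
      (isLocallySquareIntegrable_translate L₀ hθ hP Φ hΦinv hΦsq).reducedSecondMoment_lt_top hB hb
  have hαLeq : αL = (α.prod (L₀.prod L₀)).map displace := by
    rw [hαL, reducedSecondMoment_destination _ Φ hθ hinv hQ]
    have : twoPointDisplacement (translateKernel Ω L₀) Q = Kernel.const _ (L₀.prod L₀) := by
      ext1 y
      rw [twoPointDisplacement_translateKernel, Kernel.const_apply]
    rw [this, Measure.compProd_const]
  set h := tiltedConv f g with hh
  have hht : IsTestFunction h := hf.conv hg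
  let fa : Rd d × Rd d → Rd d → ℝ := fun p x => f (x + p.1)
  let gb : Rd d × Rd d → Rd d → ℝ := fun p x => g (x + p.2)
  have hshift : ∀ (p : Rd d × Rd d) y, h (displace (y, p)) = tiltedConv (fa p) (gb p) y := by
    intro p y
    rw [hh, tiltedConv, tiltedConv, ← integral_add_right_eq_self _ p.1]
    congr 1 with x
    simp only [fa, gb, displace]
    congr 2
    abel
  have hi1 : Integrable (fun r => h (displace r)) (α.prod (L₀.prod L₀)) := by
    have := hht.integrable αL
    rw [hαLeq, integrable_map_measure hht.measurable.aestronglyMeasurable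
      measurable_displace.aemeasurable] at this
    exact this
  have hint1 : ∫ y, h y ∂αL = ∫ p, ∫ y, tiltedConv (fa p) (gb p) y ∂α ∂(L₀.prod L₀) := by
    rw [hαLeq, integral_map measurable_displace.aemeasurable
      hht.measurable.aestronglyMeasurable, integral_prod_symm _ hi1]
    simp_rw [hshift]
  have hi2 : Integrable (fun p => ∫ y, tiltedConv (fa p) (gb p) y ∂α) (L₀.prod L₀) := by
    have := hi1.integral_prod_right
    simp_rw [hshift] at this
    exact this
  have hleb : ∀ p, ∫ y, tiltedConv (fa p) (gb p) y = ∫ y, h y := fun p => by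
    simp_rw [← hshift]
    have : ∀ y, displace (y, p) = y + (p.1 - p.2) := fun y => by rw [displace]; abel
    simp_rw [this]
    exact integral_add_right_eq_self h (p.1 - p.2)
  have hcov : covarianceIntegral P (destinationKernel (translateKernel Ω L₀) Φ) h =
      ∫ p, covarianceIntegral P Φ (tiltedConv (fa p) (gb p)) ∂(L₀.prod L₀) := by
    simp only [covarianceIntegral]
    rw [hstat.intensity_eq, ← hαL, hint1]
    simp_rw [hleb]
    rw [integral_sub hi2 (integrable_const _)]
    simp
  have hfour : ∀ (p : Rd d × Rd d) k, fourierFun (fa p) k * conj (fourierFun (gb p) k) =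
      conj (expNegI k (p.1 - p.2)) * (fourierFun f k * conj (fourierFun g k)) := fun p k => by
    rw [fourierFun_translate, fourierFun_translate, expNegI_sub]
    simp only [map_mul, Complex.conj_conj]
    ring
  rw [hcov, ← integral_complex_ofReal]
  have hspec : ∀ p : Rd d × Rd d, ((covarianceIntegral P Φ (tiltedConv (fa p) (gb p)) : ℝ) : ℂ) =
      (((2 * Real.pi) ^ d : ℝ) : ℂ)⁻¹ *
        ∫ k, expNegI k (-(p.1 - p.2)) * (fourierFun f k * conj (fourierFun g k)) ∂SΦ := fun p => by
    rw [hSΦ.spectral _ _ (hf.translate p.1) (hg.translate p.2)]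
    congr 2 with k
    rw [← conj_expNegI]
    exact hfour p k
  simp_rw [hspec]
  rw [integral_const_mul]
  congr 1
  have hint : Integrable (Function.uncurry fun (p : Rd d × Rd d) (k : Rd d) =>
      expNegI k (-(p.1 - p.2)) * (fourierFun f k * conj (fourierFun g k)))
      ((L₀.prod L₀).prod SΦ) :=
    Integrable.expNegI_mul measurable_snd
      ((measurable_fst.comp measurable_fst).sub (measurable_snd.comp measurable_fst)).neg
      ((hSΦ.integrable f g hf hg).comp_snd _)
  rw [integral_integral_swap hint]
  congr 1 with k
  rw [integral_mul_const]
  congr 1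
  have h2 : ∀ p : Rd d × Rd d, expNegI k (-(p.1 - p.2)) =
      conj (expNegI k p.1) * expNegI k p.2 := fun p => by
    rw [neg_sub, expNegI_sub, mul_comm]
  simp_rw [h2]
  rw [integral_prod_mul (fun a => conj (expNegI k a)) fun b => expNegI k b, integral_conj,
    ← fourierMeas_eq, mul_comm, Complex.mul_conj, Complex.normSq_eq_norm_sq]

end Translate

/-! ### Fourier transforms of differences of measures -/

section Signed

variable {d : ℕ}

lemma toSignedMeasure_sub_toJordanDecomposition {X : Type*} [MeasurableSpace X]
    (μ ν : Measure X) [IsFiniteMeasure μ] [IsFiniteMeasure ν] :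
    (μ.toSignedMeasure - ν.toSignedMeasure).toJordanDecomposition.posPart + ν =
      (μ.toSignedMeasure - ν.toSignedMeasure).toJordanDecomposition.negPart + μ := by
  set s := μ.toSignedMeasure - ν.toSignedMeasure with hs
  have h := s.toSignedMeasure_toJordanDecomposition
  rw [JordanDecomposition.toSignedMeasure] at h
  have h' := h.trans hs
  rw [sub_eq_sub_iff_add_eq_add] at h'
  rw [← Measure.toSignedMeasure_eq_toSignedMeasure_iff, Measure.toSignedMeasure_add,
    Measure.toSignedMeasure_add, h', add_comm]

lemma fourierMeas_add (μ ν : Measure (Rd d)) [IsFiniteMeasure μ] [IsFiniteMeasure ν] (k : Rd d) :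
    fourierMeas (μ + ν) k = fourierMeas μ k + fourierMeas ν k := by
  simp_rw [fourierMeas_eq]
  exact integral_add_measure (integrable_expNegI μ k measurable_id)
    (integrable_expNegI ν k measurable_id)

lemma fourierSigned_sub (μ ν : Measure (Rd d)) [IsFiniteMeasure μ] [IsFiniteMeasure ν] (k : Rd d) :
    fourierSigned (μ.toSignedMeasure - ν.toSignedMeasure) k =
      fourierMeas μ k - fourierMeas ν k := by
  have h := congrArg (fun ρ => fourierMeas ρ k) (toSignedMeasure_sub_toJordanDecomposition μ ν)
  simp only [fourierMeas_add] at h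
  rw [fourierSigned]
  linear_combination h

lemma fourierMeas_map_neg (μ : Measure (Rd d)) (k : Rd d) :
    fourierMeas (μ.map fun y => -y) k = conj (fourierMeas μ k) := by
  rw [conj_fourierMeas, fourierMeas_eq, fourierMeas_eq,
    integral_map measurable_neg.aemeasurable (continuous_expNegI_right k).aestronglyMeasurable]
  simp_rw [expNegI_neg_left]

/-- Measures that agree on bounded sets are equal. -/
lemma measure_eq_of_forall_isBounded {μ ν : Measure (Rd d)}
    (h : ∀ A : Set (Rd d), MeasurableSet A → Bornology.IsBounded A → μ A = ν A) : μ = ν :=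
  le_antisymm (measure_le_of_forall_isBounded fun A hA hb => (h A hA hb).le)
    (measure_le_of_forall_isBounded fun A hA hb => (h A hA hb).ge)

lemma toReal_withDensity_ofReal {X : Type*} [MeasurableSpace X] {μ : Measure X} {u : X → ℝ}
    {B : Set X} (hB : MeasurableSet B) (hu : IntegrableOn u B μ) :
    (μ.withDensity (fun x => ENNReal.ofReal (u x)) B).toReal = ∫ x in B, max (u x) 0 ∂μ := by
  rw [withDensity_apply _ hB, ← integral_toReal hu.1.aemeasurable.ennreal_ofReal
    (ae_of_all _ fun _ => ENNReal.ofReal_lt_top)]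
  simp_rw [ENNReal.toReal_ofReal']

lemma integral_withDensity_ofReal {X : Type*} [MeasurableSpace X] {μ : Measure X} {u : X → ℝ}
    (hu : Measurable u) (F : X → ℂ) :
    ∫ x, F x ∂(μ.withDensity fun x => ENNReal.ofReal (u x)) =
      ∫ x, ((max (u x) 0 : ℝ) : ℂ) * F x ∂μ := by
  rw [integral_withDensity_eq_integral_toReal_smul hu.ennreal_ofReal
    (ae_of_all _ fun _ => ENNReal.ofReal_lt_top)]
  simp_rw [ENNReal.toReal_ofReal', Complex.real_smul]

lemma integrable_ofReal_mul_of_le {X : Type*} [MeasurableSpace X] {μ : Measure X} {u : X → ℝ}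
    (hu : Measurable u) {C : ℝ} (hC : ∀ x, |u x| ≤ C) {F : X → ℂ} (hF : Integrable F μ) :
    Integrable (fun x => (u x : ℂ) * F x) μ :=
  hF.bdd_mul (Complex.measurable_ofReal.comp hu).aestronglyMeasurable
    (c := C) (ae_of_all _ fun x => by simpa using hC x)

lemma integrable_withDensity_ofReal {X : Type*} [MeasurableSpace X] {μ : Measure X} {u : X → ℝ}
    (hu : Measurable u) {C : ℝ} (hC : ∀ x, |u x| ≤ C) {F : X → ℂ} (hF : Integrable F μ) :
    Integrable F (μ.withDensity fun x => ENNReal.ofReal (u x)) := by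
  rw [integrable_withDensity_iff_integrable_smul' hu.ennreal_ofReal
    (ae_of_all _ fun _ => ENNReal.ofReal_lt_top)]
  simp_rw [ENNReal.toReal_ofReal', Complex.real_smul]
  refine integrable_ofReal_mul_of_le (hu.max measurable_const) (C := C) (fun x => ?_) hF
  rw [abs_of_nonneg (le_max_right _ _)]
  exact max_le ((le_abs_self _).trans (hC x)) ((abs_nonneg _).trans (hC x))

end Signed

/-! ### The asymptotic covariance of the displacements -/

section Eta

variable {d : ℕ} {Ω : Type*} [MeasurableSpace Ω] {P : Measure Ω} {θ : Rd d → Ω → Ω}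

lemma integral_expNegI_displace_prod (μ ν : Measure (Rd d)) [SFinite μ] [SFinite ν]
    (k y : Rd d) : ∫ p, expNegI k (displace (y, p)) ∂(μ.prod ν) =
      expNegI k y * (fourierMeas μ k * conj (fourierMeas ν k)) := by
  simp_rw [displace, expNegI_sub, expNegI_add, mul_assoc]
  rw [integral_const_mul, integral_prod_mul (fun a => expNegI k a) fun b => conj (expNegI k b),
    integral_conj]
  rfl

lemma palmFourier_eq (K : Kernel (Ω × Rd d) (Rd d)) [IsMarkovKernel K]
    (Φ : Ω → Measure (Rd d)) [IsFiniteMeasure (palm P θ Φ)] (k : Rd d) :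
    palmFourier P θ Φ K k = fourierMeas (meanDisplacement P θ Φ K) k := by
  let κ : Kernel Ω (Rd d) :=
    (relDisplacementKernel K).comap (fun ω => (ω, (0 : Rd d))) measurable_prodMk_right
  have h1 : meanDisplacement P θ Φ K = (palm P θ Φ).bind κ := rfl
  have hi : Integrable (fun x => expNegI k x) ((palm P θ Φ).bind κ) :=
    integrable_expNegI _ k measurable_id
  rw [fourierMeas_eq, h1, integral_bind_kernel hi]
  rfl

lemma isProbabilityMeasure_meanDisplacement (K : Kernel (Ω × Rd d) (Rd d)) [IsMarkovKernel K]
    (Φ : Ω → Measure (Rd d)) [IsProbabilityMeasure (palm P θ Φ)] :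
    IsProbabilityMeasure (meanDisplacement P θ Φ K) := by
  let κ : Kernel Ω (Rd d) :=
    (relDisplacementKernel K).comap (fun ω => (ω, (0 : Rd d))) measurable_prodMk_right
  have h1 : meanDisplacement P θ Φ K = (palm P θ Φ).bind κ := rfl
  rw [h1]
  infer_instance

/-- The difference of the reduced second moment measures of `KΦ` and `LΦ` is a finite signed
measure: it is the image under the displacement map of the reduced second moment measure of `Φ`
composed with the Jordan components of `E_{0,y}[K*_y ⊗ K*_0] - L₀ ⊗ L₀`, and the total mass of the
latter is the mixing function. -/
theorem exists_reducedSecondMoment_add_eq (Φ : Kernel Ω (Rd d)) [IsSFiniteKernel Φ]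
    [SFinite (reducedSecondMoment P Φ)] [IsProbabilityMeasure (palm P θ Φ)]
    (hθ : IsMeasurableFlow θ) (K : Kernel (Ω × Rd d) (Rd d)) [IsMarkovKernel K]
    (hK : IsInvariantKernel θ K) {L₀ : Measure (Rd d)} [IsProbabilityMeasure L₀]
    (hL : L₀ = meanDisplacement P θ Φ K) {Q : Kernel (Rd d) Ω} (hQ : IsTwoPointPalm P θ Φ Q)
    (hmix : ∫⁻ y, mixingFunction P θ Φ Q K y ∂(reducedSecondMoment P Φ) < ∞) :
    ∃ Np Nm : Measure (Rd d), IsFiniteMeasure Np ∧ IsFiniteMeasure Nm ∧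
      reducedSecondMoment P (destinationKernel K Φ) + Nm =
        reducedSecondMoment P (destinationKernel (translateKernel Ω L₀) Φ) + Np ∧
      Np Set.univ = Nm Set.univ ∧
      ∀ k, Integrable (etaIntegrand P θ Φ Q K k) (reducedSecondMoment P Φ) ∧
        fourierMeas Np k - fourierMeas Nm k =
          ∫ y, etaIntegrand P θ Φ Q K k y ∂(reducedSecondMoment P Φ) := by
  have hQm : IsMarkovKernel Q := hQ.1
  set α := reducedSecondMoment P Φ with hα
  set M := twoPointDisplacement K Q with hM
  obtain ⟨κp, κm, hκp, hκm, hadd, htv⟩ := exists_kernel_add_eq_add M (L₀.prod L₀)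
  have hmixeq : ∀ y, mixingFunction P θ Φ Q K y = tvNormSub (M y) (L₀.prod L₀) := fun y => by
    rw [hL]; rfl
  have hpm : ∀ y, κp y Set.univ = κm y Set.univ := fun y => by
    have h1 := congrArg (fun μ : Measure (Rd d × Rd d) => μ Set.univ) (hadd y)
    simp only [Measure.add_apply, measure_univ] at h1
    exact ((ENNReal.add_right_inj ENNReal.one_ne_top).1 h1).symm
  have hκfin : ∀ κ : Kernel (Rd d) (Rd d × Rd d), IsFiniteKernel κ →
      (∀ y, κ y Set.univ ≤ mixingFunction P θ Φ Q K y) → IsFiniteMeasure (α ⊗ₘ κ) :=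
    fun κ hκ hle => ⟨by
      rw [Measure.compProd_apply MeasurableSet.univ]
      exact (lintegral_mono hle).trans_lt hmix⟩
  -- the mixing condition makes the compositions with `α` finite
  have hfp : IsFiniteMeasure (α ⊗ₘ κp) := hκfin κp hκp fun y => by
    rw [hmixeq]; exact le_self_add.trans (htv y)
  have hfm : IsFiniteMeasure (α ⊗ₘ κm) := hκfin κm hκm fun y => by
    rw [hmixeq]; exact le_add_self.trans (htv y)
  refine ⟨(α ⊗ₘ κp).map displace, (α ⊗ₘ κm).map displace,
    Measure.isFiniteMeasure_map _ _, Measure.isFiniteMeasure_map _ _, ?_, ?_, fun k => ?_⟩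
  · have hinv := isInvariantKernel_translateKernel L₀ θ
    rw [reducedSecondMoment_destination K Φ hθ hK hQ,
      reducedSecondMoment_destination (translateKernel Ω L₀) Φ hθ hinv hQ,
      ← Measure.map_add _ _ measurable_displace, ← Measure.map_add _ _ measurable_displace]
    congr 1
    ext s hs
    simp only [Measure.add_apply]
    rw [Measure.compProd_apply hs, Measure.compProd_apply hs, Measure.compProd_apply hs,
      Measure.compProd_apply hs,
      ← lintegral_add_left (Kernel.measurable_kernel_prodMk_left hs),
      ← lintegral_add_left (Kernel.measurable_kernel_prodMk_left hs)]
    congr 1 with y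
    rw [twoPointDisplacement_translateKernel, ← Measure.add_apply, ← Measure.add_apply, ← hM,
      hadd]
  · rw [Measure.map_apply measurable_displace MeasurableSet.univ,
      Measure.map_apply measurable_displace MeasurableSet.univ, Set.preimage_univ,
      Measure.compProd_apply MeasurableSet.univ, Measure.compProd_apply MeasurableSet.univ]
    simp_rw [Set.preimage_univ, hpm]
  · have hm : ∀ y, Measurable fun p : Rd d × Rd d => displace (y, p) := fun y =>
      measurable_displace.comp measurable_prodMk_left
    have hMint : ∀ y, ∫ p, expNegI k (displace (y, p)) ∂(M y) = expNegI k y *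
        ∫ ω, fourierMeas (relDisplacement K ω y) k * conj (fourierMeas (relDisplacement K ω 0) k)
          ∂(Q y) := fun y => by
      have hi : Integrable (fun p => expNegI k (displace (y, p)))
          ((Q y).bind (pairDisplacement K y)) := integrable_expNegI _ k (hm y)
      rw [hM, twoPointDisplacement_eq_bind, integral_bind_kernel hi]
      simp_rw [pairDisplacement_apply, integral_expNegI_displace_prod]
      rw [integral_const_mul]
    have heta : ∀ y, etaIntegrand P θ Φ Q K k y =
        (∫ p, expNegI k (displace (y, p)) ∂(κp y)) -
          ∫ p, expNegI k (displace (y, p)) ∂(κm y) := fun y => by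
      have h1 := congrArg (fun μ => ∫ p, expNegI k (displace (y, p)) ∂μ) (hadd y)
      rw [integral_add_measure (integrable_expNegI _ k (hm y)) (integrable_expNegI _ k (hm y)),
        integral_add_measure (integrable_expNegI _ k (hm y)) (integrable_expNegI _ k (hm y)),
        hMint, integral_expNegI_displace_prod, Complex.mul_conj, Complex.normSq_eq_norm_sq] at h1
      have h2 : etaIntegrand P θ Φ Q K k y = expNegI k y *
        ((∫ ω, fourierMeas (relDisplacement K ω y) k *
          conj (fourierMeas (relDisplacement K ω 0) k) ∂(Q y)) -
          ((‖fourierMeas L₀ k‖ ^ 2 : ℝ) : ℂ)) := by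
        rw [hL, ← palmFourier_eq]; rfl
      rw [h2]
      linear_combination h1
    have hint : ∀ κ : Kernel (Rd d) (Rd d × Rd d), IsFiniteKernel κ → IsFiniteMeasure (α ⊗ₘ κ) →
        Integrable (fun y => ∫ p, expNegI k (displace (y, p)) ∂(κ y)) α ∧
        fourierMeas ((α ⊗ₘ κ).map displace) k =
          ∫ y, ∫ p, expNegI k (displace (y, p)) ∂(κ y) ∂α := fun κ _ _ => by
      have hi := integrable_expNegI (α ⊗ₘ κ) k measurable_displace
      constructor
      · have h3 := ((Measure.integrable_compProd_iff hi.1).1 hi).2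
        refine h3.mono ?_ (ae_of_all _ fun y => ?_)
        · have h4 : StronglyMeasurable fun r : Rd d × Rd d × Rd d => expNegI k (displace r) :=
            (measurable_expNegI_comp measurable_const measurable_displace).stronglyMeasurable
          exact (StronglyMeasurable.integral_kernel_prod_right' (κ := κ) h4).aestronglyMeasurable
        · exact (norm_integral_le_integral_norm _).trans (le_abs_self _)
      · rw [fourierMeas_eq, integral_map measurable_displace.aemeasurable
          (continuous_expNegI_right k).aestronglyMeasurable, Measure.integral_compProd hi]
    obtain ⟨hp1, hp2⟩ := hint κp hκp hfp
    obtain ⟨hm1, hm2⟩ := hint κm hκm hfm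
    have hfun : etaIntegrand P θ Φ Q K k = fun y =>
        (∫ p, expNegI k (displace (y, p)) ∂(κp y)) -
          ∫ p, expNegI k (displace (y, p)) ∂(κm y) := funext heta
    rw [hfun, hp2, hm2]
    exact ⟨hp1.sub hm1, (integral_sub hp1 hm1).symm⟩

end Eta

/-! ### Existence of the spectral measure of the destination -/

section Spectral

variable {d : ℕ} {Ω : Type*} [MeasurableSpace Ω] {P : Measure Ω}

lemma IsSecondOrderStationary.map_neg_reducedSecondMoment {Ψ : Kernel Ω (Rd d)} {γ : ℝ≥0∞}
    [IsSFiniteKernel Ψ] [SFinite (reducedSecondMoment P Ψ)] (h : IsSecondOrderStationary P Ψ γ) :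
    (reducedSecondMoment P Ψ).map (fun y => -y) = reducedSecondMoment P Ψ := by
  ext B hB
  have hBi : Measurable (B.indicator (1 : Rd d → ℝ≥0∞)) := measurable_one.indicator hB
  rw [← lintegral_indicator_one hB, lintegral_map hBi measurable_neg, h.lintegral_neg hBi,
    lintegral_indicator_one hB]

/-- If symmetric locally finite measures `α₁`, `α₂` differ by finite measures `Np` and `Nm`, then
the Fourier transform of the difference is real. -/
lemma conj_fourierMeas_sub {α₁ α₂ Np Nm : Measure (Rd d)} [IsLocallyFiniteMeasure α₁]
    [IsLocallyFiniteMeasure α₂] [IsFiniteMeasure Np] [IsFiniteMeasure Nm]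
    (h₁ : α₁.map (fun y => -y) = α₁) (h₂ : α₂.map (fun y => -y) = α₂)
    (h : α₁ + Nm = α₂ + Np) (k : Rd d) :
    conj (fourierMeas Np k - fourierMeas Nm k) = fourierMeas Np k - fourierMeas Nm k := by
  have hneg : α₁ + Nm.map (fun y => -y) = α₂ + Np.map (fun y => -y) := by
    nth_rewrite 1 [← h₁]
    nth_rewrite 1 [← h₂]
    rw [← Measure.map_add _ _ measurable_neg, ← Measure.map_add _ _ measurable_neg, h]
  have heq : Np + Nm.map (fun y => -y) = Np.map (fun y => -y) + Nm := by
    refine measure_eq_of_forall_isBounded fun B hB hb => ?_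
    have e1 := congrArg (fun μ : Measure (Rd d) => μ B) h
    have e2 := congrArg (fun μ : Measure (Rd d) => μ B) hneg
    simp only [Measure.add_apply] at e1 e2 ⊢
    have hfin : α₁ B + α₂ B ≠ ∞ :=
      ENNReal.add_ne_top.2 ⟨hb.measure_lt_top.ne, hb.measure_lt_top.ne⟩
    rw [← ENNReal.add_right_inj hfin]
    calc α₁ B + α₂ B + (Np B + Nm.map (fun y => -y) B)
        = (α₂ B + Np B) + (α₁ B + Nm.map (fun y => -y) B) := by ring
      _ = (α₁ B + Nm B) + (α₂ B + Np.map (fun y => -y) B) := by rw [e1, e2]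
      _ = α₁ B + α₂ B + (Np.map (fun y => -y) B + Nm B) := by ring
  have := Measure.isFiniteMeasure_map Np fun y => -y
  have := Measure.isFiniteMeasure_map Nm fun y => -y
  have hF := congrArg (fun μ => fourierMeas μ k) heq
  simp only [fourierMeas_add, fourierMeas_map_neg] at hF
  rw [map_sub]
  linear_combination -hF

/-- A spectral measure from a signed spectral density. If the covariance form of `Ψ` is the
Fourier transform of `u · S₀ + e · λ`, where `u ≥ 0` and `e` are continuous and bounded, then this
locally finite signed measure is nonnegative, being positive definite, and hence the Bartlett
spectral measure. -/
theorem exists_isBartlettSpectralMeasure {Ψ : Ω → Measure (Rd d)} {S₀ : Measure (Rd d)}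
    [IsLocallyFiniteMeasure S₀]
    (hS₀ : ∀ f g : Rd d → ℝ, IsTestFunction f → IsTestFunction g →
      Integrable (fun k => fourierFun f k * conj (fourierFun g k)) S₀)
    {u e : Rd d → ℝ} (hu : Continuous u) (he : Continuous e) (hu0 : ∀ k, 0 ≤ u k)
    {Cu Ce : ℝ} (hCu : ∀ k, |u k| ≤ Cu) (hCe : ∀ k, |e k| ≤ Ce)
    (hcov : ∀ f g : Rd d → ℝ, IsTestFunction f → IsTestFunction g →
      ((covarianceIntegral P Ψ (tiltedConv f g) : ℝ) : ℂ) = (((2 * Real.pi) ^ d : ℝ) : ℂ)⁻¹ *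
        ((∫ k, (u k : ℂ) * (fourierFun f k * conj (fourierFun g k)) ∂S₀) +
          ∫ k, (e k : ℂ) * (fourierFun f k * conj (fourierFun g k))))
    (hpos : ∀ f : Rd d → ℝ, IsTestFunction f → 0 ≤ covarianceIntegral P Ψ (tiltedConv f f)) :
    ∃ S : Measure (Rd d), IsBartlettSpectralMeasure P Ψ S ∧
      ∀ B : Set (Rd d), MeasurableSet B → Bornology.IsBounded B →
        (S B).toReal = (∫ k in B, u k ∂S₀) + ∫ k in B, e k := by
  have hne : Continuous fun k => -e k := he.neg
  have hCe' : ∀ k, |-e k| ≤ Ce := fun k => by rw [abs_neg]; exact hCe k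
  set mu := S₀.withDensity fun k => ENNReal.ofReal (u k) with hmu
  set mp := (volume : Measure (Rd d)).withDensity fun k => ENNReal.ofReal (e k) with hmp
  set mm := (volume : Measure (Rd d)).withDensity fun k => ENNReal.ofReal (-e k) with hmm
  have : IsLocallyFiniteMeasure mu := IsLocallyFiniteMeasure.withDensity_ofReal hu
  have : IsLocallyFiniteMeasure mp := IsLocallyFiniteMeasure.withDensity_ofReal he
  have : IsLocallyFiniteMeasure mm := IsLocallyFiniteMeasure.withDensity_ofReal hne
  have : IsLocallyFiniteMeasure (mu + mp) := isLocallyFiniteMeasure_of_bounded fun B _ hb => by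
    rw [Measure.add_apply]
    exact ENNReal.add_lt_top.2 ⟨hb.measure_lt_top, hb.measure_lt_top⟩
  have hiu : ∀ f g : Rd d → ℝ, IsTestFunction f → IsTestFunction g →
      Integrable (fun k => fourierFun f k * conj (fourierFun g k)) mu := fun f g hf hg =>
    integrable_withDensity_ofReal hu.measurable hCu (hS₀ f g hf hg)
  have hip : ∀ f g : Rd d → ℝ, IsTestFunction f → IsTestFunction g →
      Integrable (fun k => fourierFun f k * conj (fourierFun g k)) mp := fun f g hf hg =>
    integrable_withDensity_ofReal he.measurable hCe (hf.integrable_fourierFun_mul_conj hg)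
  have him : ∀ f g : Rd d → ℝ, IsTestFunction f → IsTestFunction g →
      Integrable (fun k => fourierFun f k * conj (fourierFun g k)) mm := fun f g hf hg =>
    integrable_withDensity_ofReal hne.measurable hCe' (hf.integrable_fourierFun_mul_conj hg)
  have hpi : (((2 * Real.pi) ^ d : ℝ) : ℂ) ≠ 0 := by
    exact_mod_cast (by positivity : (2 * Real.pi) ^ d ≠ 0)
  -- the covariance form is the Fourier transform of `mu + mp - mm`
  have hform : ∀ f g : Rd d → ℝ, IsTestFunction f → IsTestFunction g →
      (∫ k, fourierFun f k * conj (fourierFun g k) ∂(mu + mp)) -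
        ∫ k, fourierFun f k * conj (fourierFun g k) ∂mm =
        (((2 * Real.pi) ^ d * covarianceIntegral P Ψ (tiltedConv f g) : ℝ) : ℂ) :=
    fun f g hf hg => by
    have hF := hf.integrable_fourierFun_mul_conj hg
    rw [Complex.ofReal_mul, hcov f g hf hg, mul_inv_cancel_left₀ hpi,
      integral_add_measure (hiu f g hf hg) (hip f g hf hg), hmu, hmp, hmm,
      integral_withDensity_ofReal hu.measurable, integral_withDensity_ofReal he.measurable,
      integral_withDensity_ofReal hne.measurable, add_sub_assoc]
    congr 1
    · congr 1 with k
      rw [max_eq_left (hu0 k)]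
    · rw [← integral_sub]
      · congr 1 with k
        rw [← sub_mul, ← Complex.ofReal_sub]
        congr 2
        rcases le_total 0 (e k) with h0 | h0 <;> simp [h0]
      · refine integrable_ofReal_mul_of_le (he.measurable.max measurable_const) (C := Ce)
          (fun k => ?_) hF
        rw [abs_of_nonneg (le_max_right _ _)]
        exact max_le ((le_abs_self _).trans (hCe k)) ((abs_nonneg _).trans (hCe k))
      · refine integrable_ofReal_mul_of_le (hne.measurable.max measurable_const) (C := Ce)
          (fun k => ?_) hF
        rw [abs_of_nonneg (le_max_right _ _)]
        exact max_le ((le_abs_self _).trans (hCe' k)) ((abs_nonneg _).trans (hCe k))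
  have hle : mm ≤ mu + mp := measure_le_of_fourier_nonneg
    (fun f g hf hg => (hiu f g hf hg).add_measure (hip f g hf hg)) him
    (fun f g => (2 * Real.pi) ^ d * covarianceIntegral P Ψ (tiltedConv f g)) hform
    fun f hf => mul_nonneg (by positivity) (hpos f hf)
  obtain ⟨S, hS⟩ := exists_measure_add_eq_of_le hle
  have hSle : S ≤ mu + mp := hS ▸ Measure.le_add_right le_rfl
  have hSi : ∀ f g : Rd d → ℝ, IsTestFunction f → IsTestFunction g →
      Integrable (fun k => fourierFun f k * conj (fourierFun g k)) S := fun f g hf hg =>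
    ((hiu f g hf hg).add_measure (hip f g hf hg)).mono_measure hSle
  refine ⟨S, ⟨isLocallyFiniteMeasure_of_bounded fun B _ hb => (hSle B).trans_lt hb.measure_lt_top,
    hSi, fun f g hf hg => ?_⟩, fun B hB hb => ?_⟩
  · have h1 := hform f g hf hg
    rw [← hS, integral_add_measure (hSi f g hf hg) (him f g hf hg), add_sub_cancel_right,
      Complex.ofReal_mul] at h1
    rw [h1, inv_mul_cancel_left₀ hpi]
  · have hint : ∀ (μ : Measure (Rd d)) [IsLocallyFiniteMeasure μ] (v : Rd d → ℝ), Continuous v →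
        IntegrableOn v B μ := fun μ _ v hv =>
      (hv.continuousOn.integrableOn_compact hb.isCompact_closure).mono_set subset_closure
    have h1 := congrArg (fun μ : Measure (Rd d) => (μ B).toReal) hS
    have hSB : S B ≠ ∞ := ((hSle B).trans_lt hb.measure_lt_top).ne
    simp only [Measure.add_apply] at h1
    rw [ENNReal.toReal_add hSB hb.measure_lt_top.ne,
      ENNReal.toReal_add hb.measure_lt_top.ne hb.measure_lt_top.ne, hmu, hmp, hmm,
      toReal_withDensity_ofReal hB (hint _ u hu), toReal_withDensity_ofReal hB (hint _ e he),
      toReal_withDensity_ofReal hB (hint _ _ hne)] at h1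
    have h2 : ∫ k in B, max (u k) 0 ∂S₀ = ∫ k in B, u k ∂S₀ := by
      congr 1 with k
      exact max_eq_left (hu0 k)
    have h3 : (∫ k in B, max (e k) 0) - ∫ k in B, max (-e k) 0 = ∫ k in B, e k := by
      rw [← integral_sub (hint _ _ (he.max continuous_const))
        (hint _ _ (hne.max continuous_const))]
      congr 1 with k
      rcases le_total 0 (e k) with h0 | h0 <;> simp [h0]
    linarith

end Spectral

theorem theorem3p6 {d : ℕ} {Ω : Type*} [MeasurableSpace Ω] [StandardBorelSpace Ω]
    (P : Measure Ω) [IsProbabilityMeasure P]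
    -- a measurable flow leaving `P` invariant
    (θ : Rd d → Ω → Ω) (hθ : IsMeasurableFlow θ) (hP : ∀ x, MeasurePreserving (θ x) P P)
    -- an invariant, locally square-integrable random measure with positive intensity
    (Φ : Kernel Ω (Rd d)) (hΦfin : ∀ ω, IsLocallyFiniteMeasure (Φ ω))
    (hΦinv : IsInvariantMeasure θ Φ) (hΦsq : IsLocallySquareIntegrable P Φ)
    (hΦpos : 0 < intensity P Φ)
    -- an invariant probability kernel
    (K : Kernel (Ω × Rd d) (Rd d)) [IsMarkovKernel K] (hK : IsInvariantKernel θ K)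
    -- the two-point Palm probabilities, and the mixing condition
    (Q : Kernel (Rd d) Ω) (hQ : IsTwoPointPalm P θ Φ Q)
    (hmix : ∫⁻ y, mixingFunction P θ Φ Q K y ∂(reducedSecondMoment P Φ) < ∞)
    -- the Bartlett spectral measure of the source
    (SΦ : Measure (Rd d)) (hSΦ : IsBartlettSpectralMeasure P Φ SΦ) :
    IsLocallySquareIntegrable P (destination K Φ) ∧
    IsLocallySquareIntegrable P (destination (meanKernel P θ Φ K) Φ) ∧
    -- the finite signed measure `η = α_{KΦ} - α_{LΦ}`
    ∃ η : SignedMeasure (Rd d),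
      (∀ B : Set (Rd d), MeasurableSet B → Bornology.IsBounded B →
        reducedSecondMoment P (destination K Φ) B < ∞ ∧
        reducedSecondMoment P (destination (meanKernel P θ Φ K) Φ) B < ∞ ∧
        η B = (reducedSecondMoment P (destination K Φ) B).toReal -
          (reducedSecondMoment P (destination (meanKernel P θ Φ K) Φ) B).toReal) ∧
      -- the Bartlett spectral measure of the destination
      (∃! S : Measure (Rd d), IsBartlettSpectralMeasure P (destination K Φ) S) ∧
      (∀ S : Measure (Rd d), IsBartlettSpectralMeasure P (destination K Φ) S →
        ∀ B : Set (Rd d), MeasurableSet B → Bornology.IsBounded B →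
          ((S B).toReal : ℂ) =
            ((∫ k in B, ‖palmFourier P θ Φ K k‖ ^ 2 ∂SΦ : ℝ) : ℂ) +
              ∫ k in B, fourierSigned η k) ∧
      -- the formula for the Fourier transform of `η`
      (∀ k : Rd d, Integrable (etaIntegrand P θ Φ Q K k) (reducedSecondMoment P Φ) ∧
        fourierSigned η k = ∫ y, etaIntegrand P θ Φ Q K k y ∂(reducedSecondMoment P Φ)) ∧
      Continuous (fourierSigned η) ∧ fourierSigned η 0 = 0 := by
  have hQm : IsMarkovKernel Q := hQ.1
  have hΦs : IsSFiniteKernel Φ := isSFiniteKernel_of_isLocallyFiniteMeasure Φ hΦfin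
  have hpalm : IsProbabilityMeasure (palm P θ Φ) := isProbabilityMeasure_palm hθ Φ hΦsq hΦpos
  have hγ : intensity P Φ ≠ ∞ :=
    (hΦsq.lintegral_lt_top (measurableSet_unitCube d) (isBounded_unitCube d)).ne
  have hαloc : IsLocallyFiniteMeasure (reducedSecondMoment P Φ) :=
    isLocallyFiniteMeasure_of_bounded fun B hB hb => hΦsq.reducedSecondMoment_lt_top hB hb
  have hSloc := hSΦ.locallyFinite
  set L₀ := meanDisplacement P θ Φ K with hL₀
  have hL₀p : IsProbabilityMeasure L₀ := isProbabilityMeasure_meanDisplacement K Φ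
  have hKd : destination K Φ = destinationKernel K Φ := rfl
  have hLd : destination (meanKernel P θ Φ K) Φ =
    destinationKernel (translateKernel Ω L₀) Φ := rfl
  rw [hKd, hLd]
  have hLinv := isInvariantKernel_translateKernel L₀ θ
  have hLsq := isLocallySquareIntegrable_translate L₀ hθ hP Φ hΦinv hΦsq
  have hKstat := isSecondOrderStationary_destination K Φ hθ hP hΦinv hΦsq hΦpos hK hQ
  have hLstat := isSecondOrderStationary_destination (translateKernel Ω L₀) Φ hθ hP hΦinv hΦsq
    hΦpos hLinv hQ
  obtain ⟨Np, Nm, hNp, hNm, hadd, huniv, heta⟩ :=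
    exists_reducedSecondMoment_add_eq Φ hθ K hK hL₀ hQ hmix
  set αK := reducedSecondMoment P (destinationKernel K Φ) with hαK
  set αL := reducedSecondMoment P (destinationKernel (translateKernel Ω L₀) Φ) with hαL
  have hαLfin : ∀ B, MeasurableSet B → Bornology.IsBounded B → αL B < ∞ :=
    fun B hB hb => hLsq.reducedSecondMoment_lt_top hB hb
  -- local finiteness of `α_{LΦ}` passes to `α_{KΦ}`, as `α_{KΦ} ≤ α_{LΦ} + Np`
  have hαKfin : ∀ B, MeasurableSet B → Bornology.IsBounded B → αK B < ∞ := fun B hB hb => by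
    have h1 : αK B ≤ (αL + Np) B := by rw [← hadd]; exact le_self_add
    exact h1.trans_lt (ENNReal.add_lt_top.2 ⟨hαLfin B hB hb, measure_lt_top _ _⟩)
  have hαLloc : IsLocallyFiniteMeasure αL := isLocallyFiniteMeasure_of_bounded hαLfin
  have hαKloc : IsLocallyFiniteMeasure αK := isLocallyFiniteMeasure_of_bounded hαKfin
  have hF : ∀ k, fourierSigned (Np.toSignedMeasure - Nm.toSignedMeasure) k =
    fourierMeas Np k - fourierMeas Nm k := fourierSigned_sub Np Nm
  set η := Np.toSignedMeasure - Nm.toSignedMeasure with hη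
  have hcont : Continuous (fourierSigned η) := by
    rw [funext hF]
    exact (continuous_fourierMeas Np).sub (continuous_fourierMeas Nm)
  -- `η̂` is real because both reduced second moment measures are symmetric
  have hconj : ∀ k, conj (fourierSigned η k) = fourierSigned η k := fun k => by
    rw [hF]
    exact conj_fourierMeas_sub hKstat.map_neg_reducedSecondMoment
      hLstat.map_neg_reducedSecondMoment hadd k
  set e : Rd d → ℝ := fun k => (fourierSigned η k).re with he
  have hre : ∀ k, (e k : ℂ) = fourierSigned η k := fun k => Complex.conj_eq_iff_re.1 (hconj k)
  have hpF : ∀ k, palmFourier P θ Φ K k = fourierMeas L₀ k := palmFourier_eq K Φ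
  set u : Rd d → ℝ := fun k => ‖fourierMeas L₀ k‖ ^ 2 with hu
  have hecont : Continuous e := Complex.continuous_re.comp hcont
  have hucont : Continuous u := (continuous_fourierMeas L₀).norm.pow 2
  have hu1 : ∀ k, |u k| ≤ 1 := fun k => by
    rw [abs_of_nonneg (by positivity)]
    refine pow_le_one₀ (norm_nonneg _) ((norm_fourierMeas_le L₀ k).trans ?_)
    simp
  have hebd : ∀ k, |e k| ≤ Np.real Set.univ + Nm.real Set.univ := fun k => by
    refine (Complex.abs_re_le_norm _).trans ?_
    rw [hF]
    exact (norm_sub_le _ _).trans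
      (add_le_add (norm_fourierMeas_le Np k) (norm_fourierMeas_le Nm k))
  have hcov : ∀ f g : Rd d → ℝ, IsTestFunction f → IsTestFunction g →
      ((covarianceIntegral P (destinationKernel K Φ) (tiltedConv f g) : ℝ) : ℂ) =
        (((2 * Real.pi) ^ d : ℝ) : ℂ)⁻¹ *
        ((∫ k, (u k : ℂ) * (fourierFun f k * conj (fourierFun g k)) ∂SΦ) +
          ∫ k, (e k : ℂ) * (fourierFun f k * conj (fourierFun g k))) := fun f g hf hg => by
    have hht : IsTestFunction (tiltedConv f g) := hf.conv hg
    have h1 := congrArg (fun μ => ∫ y, tiltedConv f g y ∂μ) hadd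
    rw [integral_add_measure (hht.integrable αK) (hht.integrable Nm),
      integral_add_measure (hht.integrable αL) (hht.integrable Np)] at h1
    have h2 : covarianceIntegral P (destinationKernel K Φ) (tiltedConv f g) =
        covarianceIntegral P (destinationKernel (translateKernel Ω L₀) Φ) (tiltedConv f g) +
          ((∫ y, tiltedConv f g y ∂Np) - ∫ y, tiltedConv f g y ∂Nm) := by
      simp only [covarianceIntegral]
      rw [hKstat.intensity_eq, hLstat.intensity_eq]
      linarith
    have hFi := hf.integrable_fourierFun_mul_conj hg
    have hi : ∀ ν : Measure (Rd d), IsFiniteMeasure ν → Integrable fun k =>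
        fourierMeas ν (-k) * (fourierFun f k * conj (fourierFun g k)) := fun ν _ =>
      hFi.bdd_mul ((continuous_fourierMeas ν).comp continuous_neg).aestronglyMeasurable
        (ae_of_all _ fun k => norm_fourierMeas_le ν (-k))
    rw [h2, Complex.ofReal_add, Complex.ofReal_sub,
      covarianceIntegral_translate L₀ hθ hP Φ hΦinv hΦsq hΦpos hQ hSΦ hf hg,
      hf.integral_tiltedConv_measure hg, hf.integral_tiltedConv_measure hg, ← mul_sub,
      ← integral_sub (hi Np hNp) (hi Nm hNm), ← mul_add]
    congr 3 with k
    -- Parseval produces `η̂(-k)`, which is the conjugate of the real number `η̂(k)`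
    rw [← sub_mul, hre, ← hconj, hF, map_sub, conj_fourierMeas, conj_fourierMeas]
  obtain ⟨S, hS, hSB⟩ := exists_isBartlettSpectralMeasure hSΦ.integrable hucont hecont
    (fun k => by positivity) hu1 hebd hcov
    fun f hf => hKstat.covarianceIntegral_nonneg hγ hf
  refine ⟨hKstat.isLocallySquareIntegrable hαKfin, hLsq, η, fun B hB hb =>
    ⟨hαKfin B hB hb, hαLfin B hB hb, ?_⟩, ⟨S, hS, fun S' hS' => hS'.unique hS⟩,
    fun S' hS' B hB hb => ?_, fun k => ⟨(heta k).1, (hF k).trans (heta k).2⟩, hcont, ?_⟩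
  · have h1 := congrArg (fun μ : Measure (Rd d) => (μ B).toReal) hadd
    simp only [Measure.add_apply] at h1
    rw [ENNReal.toReal_add (hαKfin B hB hb).ne (measure_ne_top _ _),
      ENNReal.toReal_add (hαLfin B hB hb).ne (measure_ne_top _ _)] at h1
    rw [hη, sub_apply, Measure.toSignedMeasure_apply_measurable hB,
      Measure.toSignedMeasure_apply_measurable hB, Measure.real, Measure.real]
    linarith
  · rw [hS'.unique hS, hSB B hB hb, Complex.ofReal_add, ← integral_complex_ofReal (f := e)]
    simp_rw [hpF, hre]
    rfl
  · rw [hF, fourierMeas_eq, fourierMeas_eq]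
    simp [expNegI, Measure.real, huniv]
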